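/- **Theorem 1.1.** Let $\Gamma$ be a finite metric tree: a finite connected graph without cycles whose edges $\gamma_1,\dots,\gamma_I$ have arbitrary lengths $a_1,\dots,a_I\in(0,\infty)$ (the ratios of the lengths need not be rational). Fix a vertex $v_0$ as root and identify each edge $\gamma_i$ with the interval $[0,a_i]$ so that $0$ corresponds to the endpoint further from $v_0$ and $a_i$ to the endpoint closer to $v_0$. Let $Q=(q_1,\dots,q_I)$ with $q_i\in L^1(0,a_i)$ real-valued. A real number $\lambda$ is called an eigenvalue if there are functions $y_i:[0,a_i]\to\mathbb R$ ($i=1,\dots,I$), not all identically zero, with $y_i$ continuously differentiable and $y_i'$ absolutely continuous on $[0,a_i]$, such that $$-y_i''+q_i y_i=\lambda y_i\quad\text{a.e. on }(0,a_i),\qquad i=1,\dots,I,$$ and such that at every vertex $v$ the following hold: - (continuity) the values at $v$ of all the functions $y_i$ on edges incident to $v$ coincide; - (Kirchhoff condition) $\displaystyle\sum_{i} y_i'(a_i)=\sum_{k} y_k'(0)$, where $i$ runs over the edges whose endpoint $a_i$ is $v$ and $k$ over the edges whose endpoint $0$ is $v$ (an empty sum is $0$). At a pendant vertex these conditions reduce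 to the Neumann condition, i.e. the derivative of the function on the single incident edge vanishes at that vertex. Let $\sigma(Q)$ be the set of all eigenvalues, and $\sigma(\mathbf 0)$ the set of eigenvalues for the zero potential $q_1=\dots=q_I=0$. If $\sigma(Q)=\sigma(\mathbf 0)$, then $q_i=0$ almost everywhere on $[0,a_i]$ for every $i=1,\dots,I$. -/

import Mathlib

open MeasureTheory Set

/-- A finite metric tree with a chosen root. The vertices are the elements of `V`, the edges are
labelled by `E`, and the edge `e` is identified with the interval `[0, len e]` so that the
coordinate `0` is the endpoint further from the root and `len e` is the endpoint closer to it. -/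
structure RootedMetricTree (V E : Type*) where
  graph : SimpleGraph V
  isTree : graph.IsTree
  root : V
  /-- The edge of the combinatorial tree that carries a given label. -/
  edge : E ≃ graph.edgeSet
  /-- The endpoint with local coordinate `0`. -/
  far : E → V
  /-- The endpoint with local coordinate `len e`. -/
  near : E → V
  edge_eq : ∀ e, (edge e : Sym2 V) = s(far e, near e)
  dist_far : ∀ e, graph.dist root (far e) = graph.dist root (near e) + 1
  len : E → ℝ
  len_pos : ∀ e, 0 < len e

/-- `y` is a solution of `-y'' + q y = lam y` on `[0, a]` with derivative `dy`, in the usual sense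
for an integrable potential: `y` is differentiable up to the endpoints, `y' = dy` is absolutely
continuous, and the equation holds almost everywhere. -/
structure IsSturmLiouvilleSolution (a : ℝ) (q : ℝ → ℝ) (lam : ℝ) (y dy : ℝ → ℝ) : Prop where
  hasDerivWithinAt : ∀ x ∈ Icc 0 a, HasDerivWithinAt y (dy x) (Icc 0 a) x
  absolutelyContinuous : AbsolutelyContinuousOnInterval dy 0 a
  equation : ∀ᵐ x ∂(volume.restrict (Ioo 0 a)),
    DifferentiableAt ℝ dy x ∧ -(deriv dy x) + q x * y x = lam * y x

namespace RootedMetricTree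

variable {V E : Type*} [Fintype E] [DecidableEq V]

/-- `y = (y_e)` solves the Neumann Sturm-Liouville problem on the tree with potential `Q` and
spectral parameter `lam`; `dy e` is the derivative of `y e`. -/
structure IsNeumannSolution (T : RootedMetricTree V E) (Q : E → ℝ → ℝ) (lam : ℝ)
    (y dy : E → ℝ → ℝ) : Prop where
  solution : ∀ e, IsSturmLiouvilleSolution (T.len e) (Q e) lam (y e) (dy e)
  /-- Continuity: at each vertex `v` all the incident edges have one common value `u v`. -/
  continuity : ∃ u : V → ℝ, ∀ e, y e 0 = u (T.far e) ∧ y e (T.len e) = u (T.near e)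
  /-- Kirchhoff condition at `v`. At a vertex of degree one it involves a single edge and is the
  Neumann condition; at the root the right-hand side is an empty sum. -/
  kirchhoff : ∀ v : V, ∑ e with T.near e = v, dy e (T.len e) = ∑ e with T.far e = v, dy e 0

/-- The set of eigenvalues of the Neumann Sturm-Liouville problem with potential `Q`. -/
def neumannSpectrum (T : RootedMetricTree V E) (Q : E → ℝ → ℝ) : Set ℝ :=
  {lam | ∃ y dy : E → ℝ → ℝ, T.IsNeumannSolution Q lam y dy ∧
    ∃ e, ∃ x ∈ Icc 0 (T.len e), y e x ≠ 0}

end RootedMetricTree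

/-!
The proof rests on two facts, both consequences of comparing `Q` with the zero potential.

*The mean of `Q` vanishes.* By recurrence of the linear flow on a torus, there are arbitrarily large
eigenvalues `s ^ 2` of the zero potential for which all the phases `s * len e` are close to `0`
modulo `2 * π`. Along these `s`, normalized eigenfunctions for `Q` and for `0` are uniformly close
to multiples of `cos (s * x)` on every edge. The eigenvalues coincide, so by Green's formula the
integral of `Q` against the product of the two eigenfunctions vanishes, and the Riemann-Lebesgue
lemma gives `∑ e, ∫ Q e = 0` in the limit.

*There is a positive supersolution at `0`.* As no eigenvalue is negative, positive solutions can be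
continued from `lam = -∞` up to `lam = 0`, the flux into the root remaining nonnegative. At
`lam = 0`, the Riccati equation for the logarithmic derivative, integrated over the tree, gives
`∑ e, ∫ (y' / y) ^ 2 ≤ ∑ e, ∫ Q e = 0`. So `y` is constant and `Q = 0`.
-/

/-! ### Absolutely continuous functions and one-sided derivatives -/

theorem absolutelyContinuousOnInterval_of_hasDerivWithinAt {f f' : ℝ → ℝ} {a b : ℝ} (hab : a ≤ b)
    (hf : ∀ x ∈ Icc a b, HasDerivWithinAt f (f' x) (Icc a b) x)
    (hf' : ContinuousOn f' (Icc a b)) : AbsolutelyContinuousOnInterval f a b := by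
  obtain ⟨C, hC⟩ := isCompact_Icc.exists_bound_of_continuousOn hf'
  have hlip : LipschitzOnWith C.toNNReal f (Icc a b) :=
    (convex_Icc a b).lipschitzOnWith_of_nnnorm_hasDerivWithin_le hf fun x hx => by
      rw [← NNReal.coe_le_coe]
      exact (hC x hx).trans (Real.le_coe_toNNReal C)
  rw [← uIcc_of_le hab] at hlip
  exact hlip.absolutelyContinuousOnInterval

theorem integral_eq_sub_of_absolutelyContinuousOnInterval {F G : ℝ → ℝ} {a b x : ℝ}
    (hF : AbsolutelyContinuousOnInterval F a b)
    (hG : ∀ᵐ t ∂(volume.restrict (Ioo a b)), HasDerivAt F (G t) t)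
    (hx : x ∈ Icc a b) : ∫ t in a..x, G t = F x - F a := by
  have hF' : AbsolutelyContinuousOnInterval F a x := hF.mono (by
    rw [uIcc_of_le hx.1, uIcc_of_le (hx.1.trans hx.2)]; exact Icc_subset_Icc_right hx.2)
  rw [← hF'.integral_deriv_eq_sub]
  apply intervalIntegral.integral_congr_ae
  rw [ae_restrict_iff' measurableSet_Ioo] at hG
  filter_upwards [hG, Measure.ae_ne volume b] with t ht htb hxt
  rw [uIoc_of_le hx.1] at hxt
  exact (ht ⟨hxt.1, lt_of_le_of_ne (hxt.2.trans hx.2) htb⟩).deriv.symm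

theorem le_of_ae_hasDerivAt_nonneg {F G : ℝ → ℝ} {a b x : ℝ}
    (hF : AbsolutelyContinuousOnInterval F a b)
    (hG : ∀ᵐ t ∂(volume.restrict (Ioo a b)), HasDerivAt F (G t) t)
    (hG₀ : ∀ t ∈ Icc a b, 0 ≤ G t) (hx : x ∈ Icc a b) : F a ≤ F x := by
  rw [← sub_nonneg, ← integral_eq_sub_of_absolutelyContinuousOnInterval hF hG hx]
  exact intervalIntegral.integral_nonneg hx.1 fun t ht => hG₀ t ⟨ht.1, ht.2.trans hx.2⟩

theorem exists_absolutelyContinuous_primitive {q : ℝ → ℝ} {a b : ℝ} (hab : a ≤ b)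
    (hq : IntegrableOn q (Icc a b)) :
    ∃ p : ℝ → ℝ, Continuous p ∧ AbsolutelyContinuousOnInterval p a b ∧ p a = 0 ∧
      ∀ᵐ x ∂(volume.restrict (Ioo a b)), HasDerivAt p (q x) x := by
  have hint : Integrable ((Icc a b).indicator q) := hq.integrable_indicator measurableSet_Icc
  refine ⟨fun x => ∫ t in a..x, (Icc a b).indicator q t,
    intervalIntegral.continuous_primitive (fun _ _ => hint.intervalIntegrable) a,
    hint.intervalIntegrable.absolutelyContinuousOnInterval_intervalIntegral left_mem_uIcc,
    intervalIntegral.integral_same, ?_⟩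
  have hderiv := (hint.intervalIntegrable (a := a) (b := b)).ae_hasDerivAt_integral
  rw [uIcc_of_le hab] at hderiv
  filter_upwards [ae_restrict_mem measurableSet_Ioo, ae_restrict_of_ae hderiv] with x hx hx'
  simpa [indicator_of_mem (Ioo_subset_Icc_self hx)] using
    hx' (Ioo_subset_Icc_self hx) a (left_mem_Icc.2 hab)

theorem eqOn_zero_of_intervalIntegral_eq_zero {f : ℝ → ℝ} {a b : ℝ} (hab : a < b)
    (hf : ContinuousOn f (Icc a b)) (h₀ : ∀ x ∈ Icc a b, 0 ≤ f x) (hi : ∫ x in a..b, f x = 0) :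
    EqOn f 0 (Icc a b) := by
  intro x hx
  by_contra hne
  exact (intervalIntegral.integral_pos hab hf (fun t ht => h₀ t (Ioc_subset_Icc_self ht))
    ⟨x, hx, lt_of_le_of_ne (h₀ x hx) (Ne.symm hne)⟩).ne' hi

theorem nonneg_of_hasDerivWithinAt_left {f : ℝ → ℝ} {f' a b : ℝ} (hab : a < b)
    (hf : HasDerivWithinAt f f' (Icc a b) a) (hmin : ∀ x ∈ Icc a b, f a ≤ f x) : 0 ≤ f' := by
  have hslope := hf.mono Ioo_subset_Icc_self
  rw [hasDerivWithinAt_iff_tendsto_slope' (by simp)] at hslope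
  have := left_nhdsWithin_Ioo_neBot hab
  refine ge_of_tendsto hslope ?_
  filter_upwards [self_mem_nhdsWithin] with x hx
  rw [slope_def_field]
  exact div_nonneg (sub_nonneg.2 (hmin x (Ioo_subset_Icc_self hx))) (sub_nonneg.2 hx.1.le)

theorem nonpos_of_hasDerivWithinAt_right {f : ℝ → ℝ} {f' a b : ℝ} (hab : a < b)
    (hf : HasDerivWithinAt f f' (Icc a b) b) (hmin : ∀ x ∈ Icc a b, f b ≤ f x) : f' ≤ 0 := by
  have hslope := hf.mono Ioo_subset_Icc_self
  rw [hasDerivWithinAt_iff_tendsto_slope' (by simp)] at hslope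
  have := right_nhdsWithin_Ioo_neBot hab
  refine le_of_tendsto hslope ?_
  filter_upwards [self_mem_nhdsWithin] with x hx
  rw [slope_def_field]
  exact div_nonpos_of_nonneg_of_nonpos (sub_nonneg.2 (hmin x (Ioo_subset_Icc_self hx)))
    (sub_nonpos.2 hx.2.le)

/-! ### Linear differential equations with continuous coefficients -/

section LinearODE

variable {F : Type*} [NormedAddCommGroup F] [NormedSpace ℝ F] {a : ℝ}

/-- The operator `f ↦ (x ↦ ∫₀ˣ f)` on the Banach space of continuous functions on `[0, a]`. -/
noncomputable def primitive (F : Type*) [NormedAddCommGroup F] [NormedSpace ℝ F] (ha : 0 ≤ a) :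
    C(Icc 0 a, F) →L[ℝ] C(Icc 0 a, F) :=
  have hint (f : C(Icc 0 a, F)) (b c : ℝ) : IntervalIntegrable (IccExtend ha f) volume b c :=
    f.continuous.Icc_extend'.intervalIntegrable b c
  LinearMap.mkContinuous
    { toFun f := ⟨fun x => ∫ t in (0 : ℝ)..x, IccExtend ha f t,
        (intervalIntegral.continuous_primitive (hint f) 0).comp continuous_subtype_val⟩
      map_add' f g := by
        ext x
        exact intervalIntegral.integral_add (hint f 0 x) (hint g 0 x)
      map_smul' r f := by
        ext x
        exact intervalIntegral.integral_smul r (IccExtend ha f) }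
    a fun f => by
      refine (ContinuousMap.norm_le _ (by positivity)).2 fun x => ?_
      calc ‖∫ t in (0 : ℝ)..x, IccExtend ha f t‖ ≤ ‖f‖ * |(x : ℝ) - 0| :=
            intervalIntegral.norm_integral_le_of_norm_le_const fun t _ => f.norm_coe_le_norm _
        _ ≤ a * ‖f‖ := by
            rw [sub_zero, abs_of_nonneg x.2.1, mul_comm]
            exact mul_le_mul_of_nonneg_right x.2.2 (norm_nonneg f)

theorem primitive_apply (ha : 0 ≤ a) (f : C(Icc 0 a, F)) (x : Icc 0 a) :
    primitive F ha f x = ∫ t in (0 : ℝ)..x, IccExtend ha f t := rfl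

theorem hasDerivWithinAt_Icc_extend_primitive [CompleteSpace F] (ha : 0 ≤ a) (f : C(Icc 0 a, F))
    (x : Icc 0 a) :
    HasDerivWithinAt (IccExtend ha (primitive F ha f)) (f x) (Icc 0 a) x := by
  have h := (f.continuous.Icc_extend' (h := ha)).integral_hasStrictDerivAt 0 (x : ℝ)
  rw [IccExtend_val] at h
  refine h.hasDerivAt.hasDerivWithinAt.congr (fun t ht => ?_) ?_
  · rw [IccExtend_of_mem ha _ ht, primitive_apply]
  · rw [IccExtend_val, primitive_apply]

variable {R : Type*} [NormedRing R] [NormedAlgebra ℝ R]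

theorem norm_primitive_comp_mul_pow_apply_le (ha : 0 ≤ a) (A f : C(Icc 0 a, R)) (n : ℕ)
    (x : Icc 0 a) :
    ‖((primitive R ha ∘L ContinuousLinearMap.mul ℝ _ A) ^ n) f x‖ ≤
      (‖A‖ * x) ^ n / n.factorial * ‖f‖ := by
  induction n generalizing x with
  | zero => simpa using f.norm_coe_le_norm x
  | succ n ih =>
    rw [pow_succ', mul_apply_eq_comp]
    set g := ((primitive R ha ∘L ContinuousLinearMap.mul ℝ _ A) ^ n) f
    have hbound : ∀ t ∈ Ioc 0 (x : ℝ), ‖IccExtend ha (A * g) t‖ ≤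
        ‖A‖ * ((‖A‖ * t) ^ n / n.factorial * ‖f‖) := fun t ht => by
      rw [IccExtend_of_mem ha _ ⟨ht.1.le, ht.2.trans x.2.2⟩]
      exact (norm_mul_le _ _).trans
        (mul_le_mul (A.norm_coe_le_norm _) (ih _) (norm_nonneg _) (norm_nonneg _))
    calc ‖∫ t in (0 : ℝ)..x, IccExtend ha (A * g) t‖
        ≤ ∫ t in (0 : ℝ)..x, ‖A‖ * ((‖A‖ * t) ^ n / n.factorial * ‖f‖) :=
          intervalIntegral.norm_integral_le_of_norm_le x.2.1 (ae_of_all _ hbound)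
            (Continuous.intervalIntegrable (by fun_prop) _ _)
      _ = ∫ t in (0 : ℝ)..x, ‖A‖ ^ (n + 1) / n.factorial * ‖f‖ * t ^ n := by
          congr 1 with t
          ring
      _ = (‖A‖ * x) ^ (n + 1) / (n + 1).factorial * ‖f‖ := by
          rw [intervalIntegral.integral_const_mul, integral_pow, Nat.factorial_succ]
          push_cast
          field_simp
          ring

theorem isUnit_one_sub_of_norm_pow_lt_one {S : Type*} [NormedRing S] [HasSummableGeomSeries S]
    {K : S} {n : ℕ} (h : ‖K ^ n‖ < 1) : IsUnit (1 - K) := by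
  have hunit : IsUnit (1 - K ^ n) := isUnit_one_sub_of_norm_lt_one h
  rw [← mul_neg_geom_sum K n] at hunit
  have hcomm : Commute (1 - K) (∑ i ∈ Finset.range n, K ^ i) :=
    Commute.sum_right _ _ _ fun i _ =>
      (Commute.one_left _).sub_left ((Commute.refl K).pow_right i)
  exact (hcomm.isUnit_mul_iff.1 hunit).1

theorem isUnit_one_sub_primitive_comp_mul [CompleteSpace R] (ha : 0 ≤ a) (A : C(Icc 0 a, R)) :
    IsUnit (1 - primitive R ha ∘L ContinuousLinearMap.mul ℝ _ A) := by
  set K : C(Icc 0 a, R) →L[ℝ] C(Icc 0 a, R) := primitive R ha ∘L ContinuousLinearMap.mul ℝ _ A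
  obtain ⟨n, hn⟩ := ((FloorSemiring.tendsto_pow_div_factorial_atTop (‖A‖ * a)).eventually
    (gt_mem_nhds one_pos)).exists
  refine isUnit_one_sub_of_norm_pow_lt_one (S := C(Icc 0 a, R) →L[ℝ] C(Icc 0 a, R)) (n := n)
    (lt_of_le_of_lt (ContinuousLinearMap.opNorm_le_bound _ (by positivity) fun f => ?_) hn)
  refine (ContinuousMap.norm_le _ (by positivity)).2 fun x => ?_
  refine (norm_primitive_comp_mul_pow_apply_le ha A f n x).trans ?_
  have := x.2.1
  have := x.2.2
  gcongr

theorem exists_continuous_solution_linearODE [CompleteSpace R] {X : Type*} [TopologicalSpace X]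
    (ha : 0 ≤ a) {A : X → ℝ → R} (hA : Continuous (Function.uncurry A)) :
    ∃ Y : X → ℝ → R, Continuous (Function.uncurry Y) ∧ ∀ l, Y l 0 = 1 ∧
      ∀ x ∈ Icc 0 a, HasDerivWithinAt (Y l) (A l x * Y l x) (Icc 0 a) x := by
  let A' : C(X, C(Icc 0 a, R)) :=
    ContinuousMap.curry ⟨fun z : X × Icc 0 a => A z.1 z.2,
      hA.comp (continuous_fst.prodMk (continuous_subtype_val.comp continuous_snd))⟩
  let K (l : X) := primitive R ha ∘L ContinuousLinearMap.mul ℝ _ (A' l)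
  have hK : Continuous K :=
    ((ContinuousLinearMap.compL ℝ _ _ _ (primitive R ha)) ∘L
      ContinuousLinearMap.mul ℝ _).continuous.comp A'.continuous
  let Y (l : X) : C(Icc 0 a, R) := Ring.inverse (1 - K l) 1
  have hY : Continuous Y := by
    refine continuous_iff_continuousAt.2 fun l => ?_
    obtain ⟨v, hv⟩ := isUnit_one_sub_primitive_comp_mul ha (A' l)
    have hinv : ContinuousAt Ring.inverse (1 - K l) := by
      change ContinuousAt _ (1 - primitive R ha ∘L _)
      rw [← hv]
      exact NormedRing.inverse_continuousAt (R := C(Icc 0 a, R) →L[ℝ] C(Icc 0 a, R)) v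
    exact (ContinuousAt.comp (f := fun l => 1 - K l) hinv
      (continuous_const.sub hK).continuousAt).clm_apply continuousAt_const
  have hfix (l : X) : Y l = 1 + primitive R ha (A' l * Y l) := by
    have := DFunLike.congr_fun
      (Ring.mul_inverse_cancel _ (isUnit_one_sub_primitive_comp_mul ha (A' l))) 1
    exact sub_eq_iff_eq_add.1 this
  refine ⟨fun l => IccExtend ha (Y l), ?_, fun l => ⟨?_, fun x hx => ?_⟩⟩
  · exact (continuous_eval (F := C(Icc 0 a, R))).comp
      ((hY.comp continuous_fst).prodMk ((continuous_projIcc (h := ha)).comp continuous_snd))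
  · beta_reduce
    rw [IccExtend_left, hfix l, ContinuousMap.add_apply, primitive_apply,
      intervalIntegral.integral_same, add_zero, ContinuousMap.one_apply]
  · have h := (hasDerivWithinAt_Icc_extend_primitive ha (A' l * Y l) ⟨x, hx⟩).const_add 1
    beta_reduce
    rw [IccExtend_of_mem ha _ hx]
    exact h.congr (fun t _ => congrFun (congrArg (fun f : C(Icc 0 a, R) => IccExtend ha f)
      (hfix l)) t) (congrFun (congrArg (fun f : C(Icc 0 a, R) => IccExtend ha f) (hfix l)) x)

end LinearODE

/-! ### Sturm-Liouville equations on an interval -/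

namespace IsSturmLiouvilleSolution

variable {a lam l₁ l₂ : ℝ} {q q₁ q₂ y dy z dz : ℝ → ℝ}

theorem continuousOn (h : IsSturmLiouvilleSolution a q lam y dy) : ContinuousOn y (Icc 0 a) :=
  fun x hx => (h.hasDerivWithinAt x hx).continuousWithinAt

theorem continuousOn_deriv (ha : 0 ≤ a) (h : IsSturmLiouvilleSolution a q lam y dy) :
    ContinuousOn dy (Icc 0 a) := by
  have := h.absolutelyContinuous.continuousOn
  rwa [uIcc_of_le ha] at this

theorem absolutelyContinuous_self (ha : 0 ≤ a) (h : IsSturmLiouvilleSolution a q lam y dy) :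
    AbsolutelyContinuousOnInterval y 0 a :=
  absolutelyContinuousOnInterval_of_hasDerivWithinAt ha h.hasDerivWithinAt (h.continuousOn_deriv ha)

theorem hasDerivAt (h : IsSturmLiouvilleSolution a q lam y dy) {x : ℝ} (hx : x ∈ Ioo 0 a) :
    HasDerivAt y (dy x) x :=
  (h.hasDerivWithinAt x (Ioo_subset_Icc_self hx)).hasDerivAt (Icc_mem_nhds hx.1 hx.2)

theorem ae_hasDerivAt (h : IsSturmLiouvilleSolution a q lam y dy) :
    ∀ᵐ x ∂(volume.restrict (Ioo 0 a)),
      HasDerivAt y (dy x) x ∧ HasDerivAt dy ((q x - lam) * y x) x := by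
  filter_upwards [h.equation, ae_restrict_mem measurableSet_Ioo] with x hx hx'
  refine ⟨h.hasDerivAt hx', ?_⟩
  have := hx.1.hasDerivAt
  rwa [show deriv dy x = (q x - lam) * y x by linarith [hx.2]] at this

theorem of_ae_hasDerivAt (h₁ : ∀ x ∈ Icc 0 a, HasDerivWithinAt y (dy x) (Icc 0 a) x)
    (h₂ : AbsolutelyContinuousOnInterval dy 0 a)
    (h₃ : ∀ᵐ x ∂(volume.restrict (Ioo 0 a)), HasDerivAt dy ((q x - lam) * y x) x) :
    IsSturmLiouvilleSolution a q lam y dy where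
  hasDerivWithinAt := h₁
  absolutelyContinuous := h₂
  equation := by
    filter_upwards [h₃] with x hx
    exact ⟨hx.differentiableAt, by rw [hx.deriv]; ring⟩

theorem linear_combination (hy : IsSturmLiouvilleSolution a q lam y dy)
    (hz : IsSturmLiouvilleSolution a q lam z dz) (α β : ℝ) :
    IsSturmLiouvilleSolution a q lam (fun x => α * y x + β * z x)
      (fun x => α * dy x + β * dz x) := by
  refine of_ae_hasDerivAt (fun x hx => ((hy.hasDerivWithinAt x hx).const_mul α).add
    ((hz.hasDerivWithinAt x hx).const_mul β))
    ((hy.absolutelyContinuous.const_mul α).add (hz.absolutelyContinuous.const_mul β)) ?_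
  filter_upwards [hy.ae_hasDerivAt, hz.ae_hasDerivAt] with x hx hx'
  convert! (hx.2.const_mul α).add (hx'.2.const_mul β) using 1
  ring

theorem const_mul (hy : IsSturmLiouvilleSolution a q lam y dy) (α : ℝ) :
    IsSturmLiouvilleSolution a q lam (fun x => α * y x) (fun x => α * dy x) := by
  simpa using hy.linear_combination hy α 0

theorem green (ha : 0 ≤ a) (hy : IsSturmLiouvilleSolution a q₁ l₁ y dy)
    (hz : IsSturmLiouvilleSolution a q₂ l₂ z dz) {x : ℝ} (hx : x ∈ Icc 0 a) :
    ∫ t in (0 : ℝ)..x, ((q₁ t - l₁) - (q₂ t - l₂)) * y t * z t =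
      (dy x * z x - y x * dz x) - (dy 0 * z 0 - y 0 * dz 0) := by
  refine integral_eq_sub_of_absolutelyContinuousOnInterval
    (F := fun t => dy t * z t - y t * dz t)
    ((hy.absolutelyContinuous.mul (hz.absolutelyContinuous_self ha)).sub
      ((hy.absolutelyContinuous_self ha).mul hz.absolutelyContinuous)) ?_ hx
  filter_upwards [hy.ae_hasDerivAt, hz.ae_hasDerivAt] with t ht ht'
  convert! (ht.2.mul ht'.1).sub (ht.1.mul ht'.2) using 1
  ring

theorem wronskian_eq (ha : 0 ≤ a) (hy : IsSturmLiouvilleSolution a q lam y dy)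
    (hz : IsSturmLiouvilleSolution a q lam z dz) {x : ℝ} (hx : x ∈ Icc 0 a) :
    dy x * z x - y x * dz x = dy 0 * z 0 - y 0 * dz 0 := by
  rw [← sub_eq_zero, ← hy.green ha hz hx]
  simp

theorem energy (ha : 0 ≤ a) (hy : IsSturmLiouvilleSolution a q lam y dy) :
    ∫ t in (0 : ℝ)..a, (dy t ^ 2 + (q t - lam) * y t ^ 2) = dy a * y a - dy 0 * y 0 := by
  refine integral_eq_sub_of_absolutelyContinuousOnInterval (F := fun t => dy t * y t)
    (hy.absolutelyContinuous.mul (hy.absolutelyContinuous_self ha)) ?_ (right_mem_Icc.2 ha)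
  filter_upwards [hy.ae_hasDerivAt] with t ht
  convert! ht.2.mul ht.1 using 1
  ring

theorem riccati (ha : 0 ≤ a) (hy : IsSturmLiouvilleSolution a q lam y dy)
    (hpos : ∀ x ∈ Icc 0 a, 0 < y x) :
    ∫ t in (0 : ℝ)..a, (q t - lam - (dy t / y t) ^ 2) = dy a / y a - dy 0 / y 0 := by
  have hinv : AbsolutelyContinuousOnInterval (fun t => (y t)⁻¹) 0 a :=
    absolutelyContinuousOnInterval_of_hasDerivWithinAt ha
      (fun x hx => (hy.hasDerivWithinAt x hx).inv (hpos x hx).ne')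
      ((hy.continuousOn_deriv ha).neg.div (hy.continuousOn.pow 2)
        fun x hx => pow_ne_zero 2 (hpos x hx).ne')
  refine integral_eq_sub_of_absolutelyContinuousOnInterval
    (F := fun t => dy t / y t) ?_ ?_ (right_mem_Icc.2 ha)
  · simpa only [div_eq_mul_inv] using hy.absolutelyContinuous.fun_mul hinv
  filter_upwards [hy.ae_hasDerivAt, ae_restrict_mem measurableSet_Ioo] with t ht htm
  have hne := (hpos t (Ioo_subset_Icc_self htm)).ne'
  convert! ht.2.div ht.1 hne using 1
  field_simp

end IsSturmLiouvilleSolution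

/-- A choice `Φ l w`, with derivative `Φ' l w`, of a solution of `-y'' + q y = l y` on `[0, a]` with
the initial data `w = (y 0, y' 0)`, jointly continuous in the spectral parameter `l`, in `w` and in
the space variable. -/
structure IsSolutionOperator (a : ℝ) (q : ℝ → ℝ) (Φ Φ' : ℝ → ℝ × ℝ → ℝ → ℝ) : Prop where
  solution : ∀ l w, IsSturmLiouvilleSolution a q l (Φ l w) (Φ' l w)
  apply_zero : ∀ l w, Φ l w 0 = w.1
  deriv_zero : ∀ l w, Φ' l w 0 = w.2
  continuous : Continuous fun z : ℝ × (ℝ × ℝ) × ℝ => Φ z.1 z.2.1 z.2.2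
  continuous_deriv : Continuous fun z : ℝ × (ℝ × ℝ) × ℝ => Φ' z.1 z.2.1 z.2.2

-- Only integrability of `q` is available, so the equation is solved for `y` and its
-- quasi-derivative `w = y' - p y`, where `p' = q`: this pair solves the linear system
-- `y' = p y + w`, `w' = -(l + p²) y - p w`, which has continuous coefficients.
theorem exists_isSolutionOperator {a : ℝ} (ha : 0 ≤ a) {q : ℝ → ℝ} (hq : IntegrableOn q (Icc 0 a)) :
    ∃ Φ Φ' : ℝ → ℝ × ℝ → ℝ → ℝ, IsSolutionOperator a q Φ Φ' := by
  obtain ⟨p, hp, hpac, hp₀, hpq⟩ := exists_absolutelyContinuous_primitive ha hq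
  let ι₁ := ContinuousLinearMap.inl ℝ ℝ ℝ
  let ι₂ := ContinuousLinearMap.inr ℝ ℝ ℝ
  let π₁ := ContinuousLinearMap.fst ℝ ℝ ℝ
  let π₂ := ContinuousLinearMap.snd ℝ ℝ ℝ
  let A (l x : ℝ) : ℝ × ℝ →L[ℝ] ℝ × ℝ :=
    ι₁ ∘L (p x • π₁ + π₂) + ι₂ ∘L (-(l + p x ^ 2) • π₁ - p x • π₂)
  have hA : Continuous (Function.uncurry A) := by
    change Continuous fun z : ℝ × ℝ => A z.1 z.2
    fun_prop
  obtain ⟨Y, hYc, hY⟩ := exists_continuous_solution_linearODE ha hA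
  have hYz : Continuous fun z : ℝ × (ℝ × ℝ) × ℝ => Y z.1 z.2.2 z.2.1 :=
    (hYc.comp (continuous_fst.prodMk continuous_snd.snd)).clm_apply continuous_snd.fst
  have hderiv (l : ℝ) (w : ℝ × ℝ) {x : ℝ} (hx : x ∈ Icc 0 a) (π : ℝ × ℝ →L[ℝ] ℝ) :
      HasDerivWithinAt (fun x => π (Y l x w)) (π (A l x (Y l x w))) (Icc 0 a) x :=
    (π ∘L ContinuousLinearMap.apply ℝ (ℝ × ℝ) w).hasFDerivAt.comp_hasDerivWithinAt x
      ((hY l).2 x hx)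
  have hy (l : ℝ) (w : ℝ × ℝ) : ∀ x ∈ Icc 0 a, HasDerivWithinAt (fun x => (Y l x w).1)
      (p x * (Y l x w).1 + (Y l x w).2) (Icc 0 a) x := fun x hx => by
    simpa [A, ι₁, ι₂, π₁, π₂] using hderiv l w hx π₁
  have hw (l : ℝ) (w : ℝ × ℝ) : ∀ x ∈ Icc 0 a, HasDerivWithinAt (fun x => (Y l x w).2)
      (-(l + p x ^ 2) * (Y l x w).1 - p x * (Y l x w).2) (Icc 0 a) x := fun x hx => by
    simpa [A, ι₁, ι₂, π₁, π₂] using hderiv l w hx π₂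
  have hYx (l : ℝ) (w : ℝ × ℝ) : Continuous fun x => Y l x w :=
    hYz.comp (continuous_const.prodMk (continuous_const.prodMk continuous_id))
  refine ⟨fun l w x => (Y l x w).1, fun l w x => p x * (Y l x w).1 + (Y l x w).2,
    fun l w => .of_ae_hasDerivAt (hy l w) ?_ ?_, fun l w => ?_, fun l w => ?_, hYz.fst,
    ((hp.comp continuous_snd.snd).mul hYz.fst).add hYz.snd⟩
  · have := hYx l w
    exact (hpac.fun_mul (absolutelyContinuousOnInterval_of_hasDerivWithinAt ha (hy l w)
      (by fun_prop))).fun_add (absolutelyContinuousOnInterval_of_hasDerivWithinAt ha (hw l w)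
        (by fun_prop))
  · filter_upwards [hpq, ae_restrict_mem measurableSet_Ioo] with x hpx hx
    have hnhds := Icc_mem_nhds hx.1 hx.2
    have hx' := Ioo_subset_Icc_self hx
    convert! (hpx.mul ((hy l w x hx').hasDerivAt hnhds)).add ((hw l w x hx').hasDerivAt hnhds)
      using 1
    ring
  · rw [(hY l).1, one_apply_eq_self]
  · rw [(hY l).1, one_apply_eq_self, hp₀, zero_mul, zero_add]

namespace IsSturmLiouvilleSolution

variable {a lam : ℝ} {q y dy z dz : ℝ → ℝ}

theorem eq_zero_of_initial (ha : 0 ≤ a) (hq : IntegrableOn q (Icc 0 a))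
    (hy : IsSturmLiouvilleSolution a q lam y dy) {x₀ : ℝ} (hx₀ : x₀ ∈ Icc 0 a) (h : y x₀ = 0)
    (h' : dy x₀ = 0) : ∀ x ∈ Icc 0 a, y x = 0 ∧ dy x = 0 := by
  obtain ⟨Φ, Φ', hΦ⟩ := exists_isSolutionOperator ha hq
  set c := Φ lam (1, 0)
  set dc := Φ' lam (1, 0)
  set s := Φ lam (0, 1)
  set ds := Φ' lam (0, 1)
  have hyc {x : ℝ} (hx : x ∈ Icc 0 a) : dy x * c x - y x * dc x = dy 0 := by
    simpa [hΦ.apply_zero, hΦ.deriv_zero] using hy.wronskian_eq ha (hΦ.solution lam (1, 0)) hx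
  have hys {x : ℝ} (hx : x ∈ Icc 0 a) : dy x * s x - y x * ds x = -y 0 := by
    simpa [hΦ.apply_zero, hΦ.deriv_zero] using hy.wronskian_eq ha (hΦ.solution lam (0, 1)) hx
  have hcs {x : ℝ} (hx : x ∈ Icc 0 a) : dc x * s x - c x * ds x = -1 := by
    simpa [hΦ.apply_zero, hΦ.deriv_zero] using
      (hΦ.solution lam (1, 0)).wronskian_eq ha (hΦ.solution lam (0, 1)) hx
  have hdy₀ : dy 0 = 0 := by rw [← hyc hx₀, h, h']; ring
  have hy₀ : y 0 = 0 := by rw [← neg_eq_zero, ← hys hx₀, h, h']; ring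
  intro x hx
  have e₁ := hyc hx
  have e₂ := hys hx
  have e₃ := hcs hx
  rw [hdy₀] at e₁
  rw [hy₀, neg_zero] at e₂
  constructor
  · linear_combination s x * e₁ - c x * e₂ + y x * e₃
  · linear_combination ds x * e₁ - dc x * e₂ + dy x * e₃

theorem eq_of_initial (ha : 0 ≤ a) (hq : IntegrableOn q (Icc 0 a))
    (hy : IsSturmLiouvilleSolution a q lam y dy) (hz : IsSturmLiouvilleSolution a q lam z dz)
    (h : y 0 = z 0) (h' : dy 0 = dz 0) : ∀ x ∈ Icc 0 a, y x = z x ∧ dy x = dz x := by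
  intro x hx
  have := (hy.linear_combination hz 1 (-1)).eq_zero_of_initial ha hq (left_mem_Icc.2 ha)
    (by rw [h]; ring) (by rw [h']; ring) x hx
  exact ⟨by linarith, by linarith⟩

theorem eq_zero_of_nonneg_of_eq_zero (hq : IntegrableOn q (Icc 0 a))
    (hy : IsSturmLiouvilleSolution a q lam y dy) (hnonneg : ∀ x ∈ Icc 0 a, 0 ≤ y x) {x₀ : ℝ}
    (hx₀ : x₀ ∈ Ioo 0 a) (h : y x₀ = 0) : ∀ x ∈ Icc 0 a, y x = 0 ∧ dy x = 0 := by
  have hmin : IsLocalMin y x₀ := by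
    filter_upwards [Icc_mem_nhds hx₀.1 hx₀.2] with t ht
    rw [h]
    exact hnonneg t ht
  exact hy.eq_zero_of_initial (hx₀.1.trans hx₀.2).le hq (Ioo_subset_Icc_self hx₀) h
    (hmin.hasDerivAt_eq_zero (hy.hasDerivAt hx₀))

-- The quasi-derivative `w = dy - ψ y` satisfies `(y w)' = w² - (lam + c + ψ²) y²`.
theorem mul_sub_mul_nonneg {ψ : ℝ → ℝ} {c K : ℝ} (ha : 0 ≤ a)
    (hψ : AbsolutelyContinuousOnInterval ψ 0 a)
    (hψ' : ∀ᵐ x ∂(volume.restrict (Ioo 0 a)), HasDerivAt ψ (q x + c) x)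
    (hψK : ∀ x ∈ Icc 0 a, |ψ x| ≤ K) (hlam : K ^ 2 + c ≤ -lam)
    (hy : IsSturmLiouvilleSolution a q lam y dy) (h₀ : 0 ≤ y 0) (h₀' : ψ 0 * y 0 ≤ dy 0) :
    ∀ x ∈ Icc 0 a, 0 ≤ y x * (dy x - ψ x * y x) := by
  intro x hx
  have hyac := hy.absolutelyContinuous_self ha
  refine (mul_nonneg h₀ (sub_nonneg.2 h₀')).trans
    (le_of_ae_hasDerivAt_nonneg (F := fun x => y x * (dy x - ψ x * y x))
      (G := fun x => (dy x - ψ x * y x) ^ 2 + (-lam - c - ψ x ^ 2) * y x ^ 2)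
      (hyac.fun_mul (hy.absolutelyContinuous.fun_sub (hψ.fun_mul hyac))) ?_ (fun t ht => ?_) hx)
  · filter_upwards [hy.ae_hasDerivAt, hψ'] with t ht htψ
    convert! ht.1.mul (ht.2.sub (htψ.mul ht.1)) using 1
    simp only [Pi.sub_apply, Pi.mul_apply]
    ring
  · have : ψ t ^ 2 ≤ K ^ 2 := sq_le_sq' (abs_le.1 (hψK t ht)).1 (abs_le.1 (hψK t ht)).2
    have : 0 ≤ -lam - c - ψ t ^ 2 := by linarith
    positivity

theorem pos_of_abs_le {ψ : ℝ → ℝ} {c K : ℝ} (ha : 0 ≤ a)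
    (hψ : AbsolutelyContinuousOnInterval ψ 0 a)
    (hψ' : ∀ᵐ x ∂(volume.restrict (Ioo 0 a)), HasDerivAt ψ (q x + c) x)
    (hψK : ∀ x ∈ Icc 0 a, |ψ x| ≤ K) (hlam : K ^ 2 + c ≤ -lam)
    (hy : IsSturmLiouvilleSolution a q lam y dy) (h₀ : 0 < y 0) (h₀' : ψ 0 * y 0 ≤ dy 0) :
    ∀ x ∈ Icc 0 a, 0 < y x ∧ ψ x * y x ≤ dy x := by
  have hyac := hy.absolutelyContinuous_self ha
  have hyw := hy.mul_sub_mul_nonneg ha hψ hψ' hψK hlam h₀.le h₀'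
  have hsq : ∀ x ∈ Icc 0 a, y 0 ^ 2 ≤ y x ^ 2 * Real.exp (2 * K * x) := by
    intro x hx
    have hexp : AbsolutelyContinuousOnInterval (fun x => Real.exp (2 * K * x)) 0 a :=
      ContDiffOn.absolutelyContinuousOnInterval (by fun_prop)
    have hmono := le_of_ae_hasDerivAt_nonneg (F := fun x => y x * y x * Real.exp (2 * K * x))
      (G := fun x => 2 * (y x * (dy x - ψ x * y x) + (ψ x + K) * y x ^ 2) * Real.exp (2 * K * x))
      ((hyac.fun_mul hyac).fun_mul hexp) ?_ (fun t ht => ?_) hx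
    · simpa [sq] using hmono
    · filter_upwards [hy.ae_hasDerivAt] with t ht
      convert! (ht.1.mul ht.1).mul ((hasDerivAt_id t).const_mul (2 * K)).exp using 1
      simp only [Pi.mul_apply, id]
      ring
    · have := hyw t ht
      have : 0 ≤ ψ t + K := by linarith [(abs_le.1 (hψK t ht)).1]
      positivity
  have hpos : ∀ x ∈ Icc 0 a, 0 < y x := by
    intro x hx
    by_contra! hle
    obtain ⟨t, ht, hyt⟩ := intermediate_value_Icc' hx.1
      (hy.continuousOn.mono (Icc_subset_Icc_right hx.2)) ⟨hle, h₀.le⟩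
    have := hsq t ⟨ht.1, ht.2.trans hx.2⟩
    rw [hyt, zero_pow two_ne_zero, zero_mul] at this
    exact (pow_pos h₀ 2).not_ge this
  exact fun x hx => ⟨hpos x hx, sub_nonneg.1 (nonneg_of_mul_nonneg_right (hyw x hx) (hpos x hx))⟩

theorem eventually_atBot_pos (ha : 0 < a) (hq : IntegrableOn q (Icc 0 a)) :
    ∀ᶠ lam in Filter.atBot, ∀ y dy : ℝ → ℝ, IsSturmLiouvilleSolution a q lam y dy →
      0 < y 0 → 0 ≤ dy 0 → (∀ x ∈ Icc 0 a, 0 < y x) ∧ 0 ≤ dy a := by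
  obtain ⟨p, hp, hpac, hp₀, hpq⟩ := exists_absolutelyContinuous_primitive ha.le hq
  set c := |p a| / a
  -- The constant `c` makes `ψ a ≥ 0`, so that `ψ a * y a ≤ dy a` yields `0 ≤ dy a`.
  set ψ : ℝ → ℝ := fun x => p x + c * x with hψ
  have hψac : AbsolutelyContinuousOnInterval ψ 0 a :=
    hpac.fun_add (ContDiffOn.absolutelyContinuousOnInterval (by fun_prop))
  have hψ' : ∀ᵐ x ∂(volume.restrict (Ioo 0 a)), HasDerivAt ψ (q x + c) x := by
    filter_upwards [hpq] with x hx
    simpa using hx.fun_add ((hasDerivAt_id' x).const_mul c)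
  have hψa : 0 ≤ ψ a := by
    simp only [hψ, c, div_mul_cancel₀ _ ha.ne']
    linarith [neg_abs_le (p a)]
  obtain ⟨K, hK⟩ := isCompact_Icc.exists_bound_of_continuousOn (s := Icc 0 a) (f := ψ)
    (by fun_prop)
  filter_upwards [Filter.eventually_le_atBot (-(K ^ 2 + c))] with lam hlam y dy hy h₀ h₀'
  have hpos := hy.pos_of_abs_le ha.le hψac hψ' hK (by linarith) h₀ (by simpa [hψ, hp₀] using h₀')
  have ha' := hpos a (right_mem_Icc.2 ha.le)
  exact ⟨fun x hx => (hpos x hx).1, (mul_nonneg hψa ha'.1.le).trans ha'.2⟩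

end IsSturmLiouvilleSolution

/-! ### Rooted trees -/

namespace RootedMetricTree

section Combinatorics

variable {V E : Type*} (T : RootedMetricTree V E)

theorem adj_far_near (e : E) : T.graph.Adj (T.far e) (T.near e) := by
  rw [← SimpleGraph.mem_edgeSet, ← T.edge_eq e]
  exact (T.edge e).2

theorem far_ne_root (e : E) : T.far e ≠ T.root := by
  intro h
  have := T.dist_far e
  rw [h, SimpleGraph.dist_self] at this
  omega

theorem exists_far_eq {v : V} (hv : v ≠ T.root) : ∃ e, T.far e = v := by
  obtain ⟨p, hp⟩ := T.isTree.connected.exists_walk_length_eq_dist v T.root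
  cases p with
  | nil => exact absurd rfl hv
  | @cons _ w _ hadj p =>
    obtain ⟨e, he⟩ := T.edge.surjective ⟨s(v, w), hadj⟩
    have hends := T.edge_eq e
    have hdist := T.dist_far e
    rw [he] at hends
    rcases Sym2.eq_iff.1 hends with ⟨hv, -⟩ | ⟨hnear, hfar⟩
    · exact ⟨e, hv.symm⟩
    · rw [← hnear, ← hfar, SimpleGraph.dist_comm, SimpleGraph.dist_comm (v := v)] at hdist
      rw [SimpleGraph.Walk.length_cons] at hp
      have := SimpleGraph.dist_le p
      omega

-- A shortest walk to the root through the near end of `e` is the unique path from the far end of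
-- `e` to the root, so `far e` determines `near e`.
theorem far_injective : Function.Injective T.far := by
  have shortest (e : E) : ∃ p : T.graph.Walk (T.far e) T.root, p.IsPath ∧ p.snd = T.near e := by
    obtain ⟨p, hp⟩ := T.isTree.connected.exists_walk_length_eq_dist (T.near e) T.root
    refine ⟨.cons (T.adj_far_near e) p, SimpleGraph.Walk.isPath_of_length_eq_dist _ ?_,
      SimpleGraph.Walk.snd_cons _ _⟩
    rw [SimpleGraph.Walk.length_cons, hp, SimpleGraph.dist_comm,
      SimpleGraph.dist_comm (v := T.root), T.dist_far]
  intro e e' h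
  obtain ⟨p, hp, hsnd⟩ := shortest e
  obtain ⟨p', hp', hsnd'⟩ := shortest e'
  have hpath : p = p'.copy h.symm rfl :=
    T.isTree.existsUnique_path _ _ |>.unique hp ((SimpleGraph.Walk.isPath_copy _ _ _).2 hp')
  have hnear : T.near e = T.near e' := by
    rw [← hsnd, ← hsnd', hpath, SimpleGraph.Walk.snd, SimpleGraph.Walk.getVert_copy]
  exact T.edge.injective (Subtype.ext (by rw [T.edge_eq, T.edge_eq, h, hnear]))

theorem filter_far_eq [DecidableEq V] [Fintype E] (e : E) :
    Finset.univ.filter (fun e' => T.far e' = T.far e) = {e} := by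
  ext e'
  simp [T.far_injective.eq_iff]

theorem filter_far_root [DecidableEq V] [Fintype E] :
    Finset.univ.filter (fun e => T.far e = T.root) = ∅ := by
  ext e
  simp [T.far_ne_root]

theorem induction_down {P : V → Prop} (h₀ : P T.root) (h : ∀ e, P (T.near e) → P (T.far e))
    (v : V) : P v := by
  induction hn : T.graph.dist T.root v generalizing v with
  | zero => rwa [← T.isTree.connected.dist_eq_zero_iff.1 hn]
  | succ n ih =>
    have hv : v ≠ T.root := by
      rintro rfl
      simp at hn
    obtain ⟨e, rfl⟩ := T.exists_far_eq hv
    exact h e (ih _ (by have := T.dist_far e; omega))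

theorem exists_near_eq_root [Nonempty E] : ∃ e, T.near e = T.root := by
  have h (v : V) : v = T.root ∨ ∃ e, T.near e = T.root :=
    T.induction_down (P := fun v => v = T.root ∨ ∃ e, T.near e = T.root) (.inl rfl)
      (fun e he => .inr (he.elim (fun h => ⟨e, h⟩) id)) v
  exact (h (T.far (Classical.arbitrary E))).resolve_left (T.far_ne_root _)

/-- `T.IsChild w v` says that `w` is the far endpoint of an edge whose near endpoint is `v`. -/
def IsChild (w v : V) : Prop := ∃ e, T.far e = w ∧ T.near e = v

theorem finite_vertices (T : RootedMetricTree V E) [Finite E] : Finite V := by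
  refine Finite.of_surjective (fun o : Option E => o.elim T.root T.far) fun v => ?_
  by_cases hv : v = T.root
  · exact ⟨none, hv.symm⟩
  · exact (T.exists_far_eq hv).imp' some fun _ => id

theorem wellFounded_isChild [Finite E] : WellFounded T.IsChild := by
  have := T.finite_vertices
  obtain ⟨N, hN⟩ := (finite_range (T.graph.dist T.root)).bddAbove
  refine Subrelation.wf ?_ (measure fun v => N - T.graph.dist T.root v).wf
  rintro _ _ ⟨e, rfl, rfl⟩
  have hle : T.graph.dist T.root (T.far e) ≤ N := hN ⟨_, rfl⟩
  rw [T.dist_far] at hle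
  simp only [WellFoundedRelation.rel, InvImage, T.dist_far]
  omega

theorem induction_up [Finite E] {P : V → Prop} (h : ∀ v, (∀ e, T.near e = v → P (T.far e)) → P v)
    (v : V) : P v :=
  T.wellFounded_isChild.induction v fun v ih => h v fun e he => ih _ ⟨e, rfl, he⟩

open Classical in
/-- The product of the weights `c e` over the edges `e` on the path from the root to `v`. -/
noncomputable def pathProduct (c : E → ℝ) (v : V) : ℝ :=
  if hv : v = T.root then 1
  else c (T.exists_far_eq hv).choose * pathProduct c (T.near (T.exists_far_eq hv).choose)
termination_by T.graph.dist T.root v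
decreasing_by
  conv_rhs => rw [← (T.exists_far_eq hv).choose_spec, T.dist_far]
  exact Nat.lt_succ_self _

theorem pathProduct_root (c : E → ℝ) : T.pathProduct c T.root = 1 := by
  rw [pathProduct, dif_pos rfl]

theorem pathProduct_far (c : E → ℝ) (e : E) :
    T.pathProduct c (T.far e) = c e * T.pathProduct c (T.near e) := by
  have hchoose := T.far_injective (T.exists_far_eq (T.far_ne_root e)).choose_spec
  rw [pathProduct, dif_neg (T.far_ne_root e), hchoose]

theorem pathProduct_pos {c : E → ℝ} (hc : ∀ e, 0 < c e) (v : V) : 0 < T.pathProduct c v := by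
  induction v using T.induction_down with
  | h₀ => rw [pathProduct_root]; exact one_pos
  | h e ih => rw [pathProduct_far]; exact mul_pos (hc e) ih

variable [Fintype E] [DecidableEq V] {G : E → ℝ → ℝ}

/-- The solution `m` of the recursion `m v = ∑ G e (m (far e))` over the edges `e` with near
endpoint `v`. If `G e r` is the logarithmic derivative at `len e` of the solution on `e` that has
logarithmic derivative `r` at `0`, then `m v` is that of a solution on the subtree hanging at `v`,
i.e. its Weyl function. -/
noncomputable def weylFunction (G : E → ℝ → ℝ) : V → ℝ :=
  T.wellFounded_isChild.fix fun v m => ∑ e : {e // T.near e = v}, G e (m (T.far e) ⟨e, rfl, e.2⟩)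

theorem weylFunction_eq (G : E → ℝ → ℝ) (v : V) :
    T.weylFunction G v = ∑ e with T.near e = v, G e (T.weylFunction G (T.far e)) := by
  rw [weylFunction, WellFounded.fix_eq]
  exact (Finset.sum_subtype (Finset.univ.filter fun e => T.near e = v)
    (fun e => Finset.mem_filter_univ e) fun e => G e (T.weylFunction G (T.far e))).symm

theorem weylFunction_mem (S : AddSubmonoid ℝ)
    (hG : ∀ e, T.weylFunction G (T.far e) ∈ S → G e (T.weylFunction G (T.far e)) ∈ S) (v : V) :
    T.weylFunction G v ∈ S := by
  induction v using T.induction_up with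
  | h v ih =>
    rw [weylFunction_eq]
    exact S.sum_mem fun e he => hG e (ih e (Finset.mem_filter.1 he).2)

theorem weylFunction_neg (G : E → ℝ → ℝ) (v : V) :
    T.weylFunction (fun e r => -G e (-r)) v = -T.weylFunction G v := by
  induction v using T.induction_up with
  | h v ih =>
    rw [weylFunction_eq, weylFunction_eq, ← Finset.sum_neg_distrib]
    refine Finset.sum_congr rfl fun e he => ?_
    rw [ih e (Finset.mem_filter.1 he).2, neg_neg]

theorem continuousAt_weylFunction {X : Type*} [TopologicalSpace X] {G : X → E → ℝ → ℝ} {x₀ : X}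
    (hG : ∀ e, ContinuousAt (fun z : X × ℝ => G z.1 e z.2)
      (x₀, T.weylFunction (G x₀) (T.far e))) (v : V) :
    ContinuousAt (fun x => T.weylFunction (G x) v) x₀ := by
  induction v using T.induction_up with
  | h v ih =>
    simp only [T.weylFunction_eq _ v]
    exact tendsto_finsetSum _ fun e he => ContinuousAt.comp
      (f := fun x => (x, T.weylFunction (G x) (T.far e))) (hG e)
      (continuousAt_id.prodMk (ih e (Finset.mem_filter.1 he).2))

theorem sum_edges_eq_sum_vertices [Fintype V] (f g : E → ℝ) (w : V → ℝ) :
    ∑ e, (f e * w (T.near e) - g e * w (T.far e)) =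
      ∑ v, w v * ((∑ e with T.near e = v, f e) - ∑ e with T.far e = v, g e) := by
  rw [Finset.sum_sub_distrib, ← Finset.sum_fiberwise Finset.univ T.near,
    ← Finset.sum_fiberwise (f := fun e => g e * w (T.far e)) Finset.univ T.far,
    ← Finset.sum_sub_distrib]
  refine Finset.sum_congr rfl fun v _ => ?_
  rw [mul_sub, Finset.mul_sum, Finset.mul_sum]
  congr 1 <;>
  · refine Finset.sum_congr rfl fun e he => ?_
    rw [(Finset.mem_filter.1 he).2, mul_comm]

end Combinatorics

end RootedMetricTree

/-! ### Solutions on the tree -/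

namespace RootedMetricTree

section Solutions

variable {V E : Type*} [Fintype E] [DecidableEq V] {T : RootedMetricTree V E}
  {Q Q' : E → ℝ → ℝ} {lam lam' : ℝ} {u : V → ℝ} {y dy z dz : E → ℝ → ℝ}

/-- `y` satisfies every condition of `IsNeumannSolution` except the Kirchhoff condition at the root;
`u v` is the common value at the vertex `v`. -/
structure IsSolutionOffRoot (T : RootedMetricTree V E) (Q : E → ℝ → ℝ) (lam : ℝ) (u : V → ℝ)
    (y dy : E → ℝ → ℝ) : Prop where
  solution : ∀ e, IsSturmLiouvilleSolution (T.len e) (Q e) lam (y e) (dy e)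
  apply_zero : ∀ e, y e 0 = u (T.far e)
  apply_len : ∀ e, y e (T.len e) = u (T.near e)
  kirchhoff : ∀ e, ∑ e' with T.near e' = T.far e, dy e' (T.len e') = dy e 0

theorem IsSolutionOffRoot.isNeumannSolution (h : T.IsSolutionOffRoot Q lam u y dy)
    (hroot : ∑ e with T.near e = T.root, dy e (T.len e) = 0) : T.IsNeumannSolution Q lam y dy where
  solution := h.solution
  continuity := ⟨u, fun e => ⟨h.apply_zero e, h.apply_len e⟩⟩
  kirchhoff v := by
    by_cases hv : v = T.root
    · rw [hv, hroot, T.filter_far_root, Finset.sum_empty]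
    · obtain ⟨e, rfl⟩ := T.exists_far_eq hv
      rw [h.kirchhoff, T.filter_far_eq, Finset.sum_singleton]

theorem IsNeumannSolution.exists_isSolutionOffRoot (h : T.IsNeumannSolution Q lam y dy) :
    (∃ u, T.IsSolutionOffRoot Q lam u y dy) ∧
      ∑ e with T.near e = T.root, dy e (T.len e) = 0 := by
  obtain ⟨u, hu⟩ := h.continuity
  refine ⟨⟨u, h.solution, fun e => (hu e).1, fun e => (hu e).2, fun e => ?_⟩, ?_⟩
  · rw [h.kirchhoff, T.filter_far_eq, Finset.sum_singleton]
  · rw [h.kirchhoff, T.filter_far_root, Finset.sum_empty]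

section Gluing

variable {f df : E → ℝ → ℝ} {m : V → ℝ}

theorem sum_flux_eq_mul (hne : ∀ e, f e (T.len e) ≠ 0)
    (hm : ∀ v, m v = ∑ e with T.near e = v, df e (T.len e) / f e (T.len e))
    (hu : ∀ e, u (T.far e) * f e (T.len e) = u (T.near e)) (v : V) :
    ∑ e with T.near e = v, u (T.far e) * df e (T.len e) = u v * m v := by
  rw [hm, Finset.mul_sum]
  refine Finset.sum_congr rfl fun e he => ?_
  rw [← (Finset.mem_filter.1 he).2, ← hu, mul_assoc, mul_div_cancel₀ _ (hne e)]

theorem isSolutionOffRoot_of_logDeriv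
    (hf : ∀ e, IsSturmLiouvilleSolution (T.len e) (Q e) lam (f e) (df e)) (h₀ : ∀ e, f e 0 = 1)
    (h₀' : ∀ e, df e 0 = m (T.far e)) (hne : ∀ e, f e (T.len e) ≠ 0)
    (hm : ∀ v, m v = ∑ e with T.near e = v, df e (T.len e) / f e (T.len e))
    (hu : ∀ e, u (T.far e) * f e (T.len e) = u (T.near e)) :
    T.IsSolutionOffRoot Q lam u (fun e x => u (T.far e) * f e x)
      (fun e x => u (T.far e) * df e x) where
  solution e := (hf e).const_mul _
  apply_zero e := by rw [h₀, mul_one]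
  apply_len := hu
  kirchhoff e := by rw [sum_flux_eq_mul hne hm hu, h₀']

theorem exists_isSolutionOffRoot
    (hf : ∀ e, IsSturmLiouvilleSolution (T.len e) (Q e) lam (f e) (df e)) (h₀ : ∀ e, f e 0 = 1)
    (h₀' : ∀ e, df e 0 = m (T.far e)) (hne : ∀ e, f e (T.len e) ≠ 0)
    (hm : ∀ v, m v = ∑ e with T.near e = v, df e (T.len e) / f e (T.len e)) :
    ∃ u, u T.root = 1 ∧ ((∀ e, 0 < f e (T.len e)) → ∀ v, 0 < u v) ∧
      T.IsSolutionOffRoot Q lam u (fun e x => u (T.far e) * f e x)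
        (fun e x => u (T.far e) * df e x) ∧
      ∑ e with T.near e = T.root, u (T.far e) * df e (T.len e) = m T.root := by
  have hu (e : E) : T.pathProduct (fun e => (f e (T.len e))⁻¹) (T.far e) * f e (T.len e) =
      T.pathProduct (fun e => (f e (T.len e))⁻¹) (T.near e) := by
    rw [pathProduct_far, mul_right_comm, inv_mul_cancel₀ (hne e), one_mul]
  refine ⟨_, T.pathProduct_root _, fun hpos => T.pathProduct_pos fun e => inv_pos.2 (hpos e),
    isSolutionOffRoot_of_logDeriv hf h₀ h₀' hne hm hu, ?_⟩
  rw [sum_flux_eq_mul hne hm hu, pathProduct_root, one_mul]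

end Gluing

theorem IsNeumannSolution.const_mul (h : T.IsNeumannSolution Q lam y dy) (c : ℝ) :
    T.IsNeumannSolution Q lam (fun e x => c * y e x) (fun e x => c * dy e x) where
  solution e := (h.solution e).const_mul c
  continuity := by
    obtain ⟨u, hu⟩ := h.continuity
    exact ⟨fun v => c * u v, fun e => ⟨by rw [(hu e).1], by rw [(hu e).2]⟩⟩
  kirchhoff v := by rw [← Finset.mul_sum, ← Finset.mul_sum, h.kirchhoff v]

theorem IsNeumannSolution.sum_integral_mul_eq_zero (hy : T.IsNeumannSolution Q lam y dy)
    (hz : T.IsNeumannSolution Q' lam' z dz) :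
    ∑ e, ∫ t in (0 : ℝ)..(T.len e), ((Q e t - lam) - (Q' e t - lam')) * y e t * z e t = 0 := by
  have := T.finite_vertices
  have := Fintype.ofFinite V
  obtain ⟨u, hu⟩ := hy.continuity
  obtain ⟨w, hw⟩ := hz.continuity
  calc ∑ e, ∫ t in (0 : ℝ)..(T.len e), ((Q e t - lam) - (Q' e t - lam')) * y e t * z e t
      = ∑ e, ((dy e (T.len e) * w (T.near e) - dy e 0 * w (T.far e)) -
          (dz e (T.len e) * u (T.near e) - dz e 0 * u (T.far e))) := by
        refine Finset.sum_congr rfl fun e _ => ?_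
        rw [(hy.solution e).green (T.len_pos e).le (hz.solution e)
          (right_mem_Icc.2 (T.len_pos e).le), (hu e).1, (hu e).2, (hw e).1, (hw e).2]
        ring
    _ = 0 := by
        rw [Finset.sum_sub_distrib, T.sum_edges_eq_sum_vertices, T.sum_edges_eq_sum_vertices]
        simp [hy.kirchhoff, hz.kirchhoff]

end Solutions

end RootedMetricTree

/-! ### Large eigenvalues of the zero potential -/

open Filter Topology

theorem isSturmLiouvilleSolution_cos_add_sin (a s α β : ℝ) :
    IsSturmLiouvilleSolution a 0 (s ^ 2) (fun x => α * Real.cos (s * x) + β * Real.sin (s * x))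
      (fun x => s * (-α * Real.sin (s * x) + β * Real.cos (s * x))) := by
  have hsin (x : ℝ) : HasDerivAt (fun x => Real.sin (s * x)) (Real.cos (s * x) * s) x := by
    simpa using ((hasDerivAt_id x).const_mul s).sin
  have hcos (x : ℝ) : HasDerivAt (fun x => Real.cos (s * x)) (-Real.sin (s * x) * s) x := by
    simpa using ((hasDerivAt_id x).const_mul s).cos
  refine IsSturmLiouvilleSolution.of_ae_hasDerivAt (fun x _ => ?_) ?_ (ae_of_all _ fun x => ?_)
  · convert! (((hcos x).const_mul α).add ((hsin x).const_mul β)).hasDerivWithinAt using 1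
    ring
  · exact ContDiffOn.absolutelyContinuousOnInterval (by fun_prop)
  · convert! (((hsin x).const_mul (-α)).add ((hcos x).const_mul β)).const_mul s using 1
    simp only [Pi.zero_apply]
    ring

/-- If `-y'' = s² y`, then `logDerivTransfer θ` carries the logarithmic derivative `y' / (s y)`
along an interval of length `θ / s`. -/
noncomputable def logDerivTransfer (θ : Real.Angle) (r : ℝ) : ℝ :=
  (-θ.sin + r * θ.cos) / (θ.cos + r * θ.sin)

theorem logDerivTransfer_neg (θ : Real.Angle) (r : ℝ) :
    logDerivTransfer (-θ) r = -logDerivTransfer θ (-r) := by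
  rw [logDerivTransfer, logDerivTransfer, Real.Angle.sin_neg, Real.Angle.cos_neg, ← neg_div]
  ring_nf

theorem continuousAt_logDerivTransfer {θ : Real.Angle} {r : ℝ} (h : θ.cos + r * θ.sin ≠ 0) :
    ContinuousAt (fun z : Real.Angle × ℝ => logDerivTransfer z.1 z.2) (θ, r) := by
  have hsin := Real.Angle.continuous_sin
  have hcos := Real.Angle.continuous_cos
  have hnum : Continuous fun z : Real.Angle × ℝ => -z.1.sin + z.2 * z.1.cos := by fun_prop
  have hden : Continuous fun z : Real.Angle × ℝ => z.1.cos + z.2 * z.1.sin := by fun_prop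
  exact hnum.continuousAt.div hden.continuousAt h

namespace RootedMetricTree

section ZeroPotential

variable {V E : Type*} (T : RootedMetricTree V E)

/-- The phases, modulo `2π`, by which `cos (s x)` and `sin (s x)` advance along the edges. -/
noncomputable def phase (s : ℝ) : E → Real.Angle := fun e => ((s * T.len e : ℝ) : Real.Angle)

theorem continuous_phase : Continuous T.phase := by
  have := Real.Angle.continuous_coe
  unfold phase
  fun_prop

theorem phase_add (s t : ℝ) : T.phase (s + t) = T.phase s + T.phase t := by
  ext1 e
  simp only [phase, add_mul, Real.Angle.coe_add, Pi.add_apply]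

theorem phase_zero : T.phase 0 = 0 := by
  ext1 e
  simp only [phase, zero_mul, Real.Angle.coe_zero, Pi.zero_apply]

theorem frequently_phase_natCast [Finite E] {p : (E → Real.Angle) → Prop}
    (hp : ∀ᶠ θ in 𝓝 0, p θ) : ∃ᶠ n : ℕ in atTop, p (T.phase n) := by
  have : Fact (0 < 2 * Real.pi) := ⟨Real.two_pi_pos⟩
  have : CompactSpace Real.Angle := inferInstanceAs (CompactSpace (AddCircle (2 * Real.pi)))
  have hn (n : ℕ) : T.phase n = n • T.phase 1 := by
    ext1 e
    simp only [phase, one_mul, Pi.smul_apply, ← Real.Angle.natCast_mul_eq_nsmul]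
  simp only [hn]
  exact (mapClusterPt_zero_atTop_nsmul (T.phase 1)).frequently hp

variable [Fintype E] [DecidableEq V] {T} {θ : E → Real.Angle}

/-- The Weyl function of the zero potential at spectral parameter `s²`, divided by `s`, as a
function of the phases. -/
noncomputable def phaseWeyl (T : RootedMetricTree V E) (θ : E → Real.Angle) : V → ℝ :=
  T.weylFunction fun e => logDerivTransfer (θ e)

/-- The phases `θ` are so small that no denominator in the recursion for `phaseWeyl T θ`
vanishes. -/
def IsRegularPhase (T : RootedMetricTree V E) (θ : E → Real.Angle) : Prop :=
  ∀ e, 0 < (θ e).cos ∧ 0 < (θ e).cos + T.phaseWeyl θ (T.far e) * (θ e).sin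

theorem IsRegularPhase.continuousAt (hθ : T.IsRegularPhase θ) (v : V) :
    ContinuousAt (T.phaseWeyl · v) θ := by
  have hG (e : E) : ContinuousAt (fun z : (E → Real.Angle) × ℝ => logDerivTransfer (z.1 e) z.2)
      (θ, T.phaseWeyl θ (T.far e)) := ContinuousAt.comp
    (f := fun z : (E → Real.Angle) × ℝ => (z.1 e, z.2))
    (g := fun z : Real.Angle × ℝ => logDerivTransfer z.1 z.2)
    (continuousAt_logDerivTransfer (hθ e).2.ne') (by fun_prop)
  simp only [phaseWeyl] at hG ⊢
  exact T.continuousAt_weylFunction (X := E → Real.Angle)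
    (G := fun θ e => logDerivTransfer (θ e)) (x₀ := θ) hG v

theorem phaseWeyl_neg (θ : E → Real.Angle) (v : V) : T.phaseWeyl (-θ) v = -T.phaseWeyl θ v := by
  rw [phaseWeyl, phaseWeyl, ← weylFunction_neg]
  congr 1
  ext e r
  exact logDerivTransfer_neg (θ e) r

theorem IsRegularPhase.neg (hθ : T.IsRegularPhase θ) : T.IsRegularPhase (-θ) := fun e => by
  simpa [phaseWeyl_neg] using hθ e

theorem IsRegularPhase.phaseWeyl_nonneg (hθ : T.IsRegularPhase θ) (hsin : ∀ e, (θ e).sin ≤ 0)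
    (v : V) : 0 ≤ T.phaseWeyl θ v :=
  T.weylFunction_mem (AddSubmonoid.nonneg ℝ) (fun e h =>
    div_nonneg (add_nonneg (neg_nonneg.2 (hsin e)) (mul_nonneg h (hθ e).1.le)) (hθ e).2.le) v

theorem IsRegularPhase.phaseWeyl_nonpos (hθ : T.IsRegularPhase θ) (hsin : ∀ e, 0 ≤ (θ e).sin)
    (v : V) : T.phaseWeyl θ v ≤ 0 := by
  have := hθ.neg.phaseWeyl_nonneg (fun e => by simpa using hsin e) v
  rwa [phaseWeyl_neg, neg_nonneg] at this

theorem eventually_isRegularPhase : ∀ᶠ θ in 𝓝 0, T.IsRegularPhase θ := by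
  have h₀ : T.IsRegularPhase 0 := fun e => by simp
  have hsin (e : E) : Continuous fun θ : E → Real.Angle => (θ e).sin :=
    Real.Angle.continuous_sin.comp (continuous_apply e)
  have hcos (e : E) : Continuous fun θ : E → Real.Angle => (θ e).cos :=
    Real.Angle.continuous_cos.comp (continuous_apply e)
  refine eventually_all.2 fun e => ((hcos e).continuousAt.eventually_const_lt (h₀ e).1).and ?_
  exact ((hcos e).continuousAt.add ((h₀.continuousAt (T.far e)).mul
    (hsin e).continuousAt)).eventually_const_lt (h₀ e).2

theorem IsRegularPhase.sq_mem_neumannSpectrum [Nonempty E] {s : ℝ}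
    (hs : T.IsRegularPhase (T.phase s)) (hroot : T.phaseWeyl (T.phase s) T.root = 0) :
    s ^ 2 ∈ T.neumannSpectrum 0 := by
  set m := T.phaseWeyl (T.phase s) with hm
  have hne (e : E) : 0 < 1 * Real.cos (s * T.len e) + m (T.far e) * Real.sin (s * T.len e) := by
    simpa [phase] using (hs e).2
  obtain ⟨u, hu₀, -, hu, hflux⟩ := T.exists_isSolutionOffRoot
    (m := fun v => s * m v) (fun e => isSturmLiouvilleSolution_cos_add_sin (T.len e) s 1
      (m (T.far e))) (by simp) (by simp) (fun e => (hne e).ne') fun v => by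
    rw [hm, phaseWeyl, weylFunction_eq, ← phaseWeyl, ← hm, Finset.mul_sum]
    refine Finset.sum_congr rfl fun e _ => ?_
    simp [logDerivTransfer, phase, mul_div_assoc]
  obtain ⟨e, he⟩ := T.exists_near_eq_root
  refine ⟨_, _, hu.isNeumannSolution (hflux.trans (by rw [hroot, mul_zero])), e, T.len e,
    right_mem_Icc.2 (T.len_pos e).le, ?_⟩
  rw [hu.apply_len, he, hu₀]
  exact one_ne_zero

theorem exists_phaseWeyl_eq_zero {θ : E → Real.Angle} {t : ℝ} (ht : 0 ≤ t)
    (hreg : ∀ τ ∈ Icc (-t) t, T.IsRegularPhase (θ + T.phase τ))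
    (hleft : ∀ e, ((θ + T.phase (-t)) e).sin ≤ 0) (hright : ∀ e, 0 ≤ ((θ + T.phase t) e).sin) :
    ∃ τ ∈ Icc (-t) t, T.phaseWeyl (θ + T.phase τ) T.root = 0 := by
  have htt : -t ≤ t := by linarith
  have hcont : ContinuousOn (fun τ => T.phaseWeyl (θ + T.phase τ) T.root) (Icc (-t) t) :=
    fun τ hτ => (((hreg τ hτ).continuousAt T.root).comp (f := fun τ => θ + T.phase τ)
      (T.continuous_phase.const_add θ).continuousAt).continuousWithinAt
  exact intermediate_value_Icc' htt hcont
    ⟨(hreg t (right_mem_Icc.2 htt)).phaseWeyl_nonpos hright _,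
      (hreg (-t) (left_mem_Icc.2 htt)).phaseWeyl_nonneg hleft _⟩

theorem eventually_exists_phaseWeyl_eq_zero {p : (E → Real.Angle) → Prop} (hp : ∀ᶠ θ in 𝓝 0, p θ) :
    ∃ t : ℝ, ∀ᶠ θ in 𝓝 0, ∃ τ ∈ Icc (-t) t, p (θ + T.phase τ) ∧
      T.IsRegularPhase (θ + T.phase τ) ∧ T.phaseWeyl (θ + T.phase τ) T.root = 0 := by
  have hgood : ∀ᶠ τ in 𝓝 0, ∀ᶠ θ in 𝓝 (T.phase τ), p θ ∧ T.IsRegularPhase θ :=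
    (T.continuous_phase.tendsto' 0 0 T.phase_zero).eventually
      (hp.and eventually_isRegularPhase).eventually_nhds
  obtain ⟨ε, hε, hball⟩ := Metric.nhds_basis_closedBall.eventually_iff.1 hgood
  obtain ⟨t, ⟨ht, htε⟩, htπ⟩ : ∃ t ∈ Ioc 0 ε, ∀ e, t * T.len e < Real.pi := by
    refine (Filter.Eventually.and (Ioc_mem_nhdsGT hε)
      (eventually_all.2 fun e => nhdsWithin_le_nhds ?_)).exists
    have : Continuous fun t => t * T.len e := by fun_prop
    exact this.continuousAt.eventually_lt_const (by simpa using Real.pi_pos)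
  have hsin (e : E) : 0 < Real.sin (t * T.len e) :=
    Real.sin_pos_of_pos_of_lt_pi (mul_pos ht (T.len_pos e)) (htπ e)
  have hcont (τ : ℝ) (e : E) : Continuous fun θ => ((θ + T.phase τ) e).sin :=
    Real.Angle.continuous_sin.comp ((continuous_apply e).comp (continuous_add_const _))
  have hleft : ∀ᶠ θ in 𝓝 0, ∀ e, ((θ + T.phase (-t)) e).sin < 0 := eventually_all.2 fun e =>
    (hcont (-t) e).continuousAt.eventually_lt_const (by simpa [phase] using hsin e)
  have hright : ∀ᶠ θ in 𝓝 0, ∀ e, 0 < ((θ + T.phase t) e).sin := eventually_all.2 fun e =>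
    (hcont t e).continuousAt.eventually_const_lt (by simpa [phase] using hsin e)
  have htube : ∀ᶠ θ in 𝓝 0, ∀ τ ∈ Icc (-t) t,
      p (θ + T.phase τ) ∧ T.IsRegularPhase (θ + T.phase τ) := by
    refine isCompact_Icc.eventually_forall_of_forall_eventually fun τ hτ => ?_
    have hsum : Continuous fun z : (E → Real.Angle) × ℝ => z.1 + T.phase z.2 :=
      continuous_fst.add (T.continuous_phase.comp continuous_snd)
    refine (hsum.tendsto' (0, τ) (T.phase τ) (zero_add _)).eventually (hball ?_)
    rw [Real.closedBall_eq_Icc, zero_sub, zero_add]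
    exact Icc_subset_Icc (neg_le_neg htε) htε hτ
  refine ⟨t, ?_⟩
  filter_upwards [hleft, hright, htube] with θ hθl hθr hθ
  obtain ⟨τ, hτ, hroot⟩ := exists_phaseWeyl_eq_zero ht.le (fun τ hτ => (hθ τ hτ).2)
    (fun e => (hθl e).le) fun e => (hθr e).le
  exact ⟨τ, hτ, (hθ τ hτ).1, (hθ τ hτ).2, hroot⟩

theorem frequently_sq_mem_neumannSpectrum_zero [Nonempty E] :
    ∃ᶠ s in atTop ⊓ comap T.phase (𝓝 0), s ^ 2 ∈ T.neumannSpectrum 0 := by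
  refine (atTop_basis.inf ((𝓝 0).basis_sets.comap T.phase)).frequently_iff.2 ?_
  rintro ⟨S, U⟩ ⟨-, hU⟩
  obtain ⟨t, ht⟩ := eventually_exists_phaseWeyl_eq_zero (T := T) hU
  obtain ⟨n, ⟨τ, hτ, hτU, hreg, hroot⟩, hn⟩ := ((T.frequently_phase_natCast ht).and_eventually
    (tendsto_natCast_atTop_atTop.eventually_ge_atTop (S + t))).exists
  rw [← phase_add] at hτU hreg hroot
  exact ⟨n + τ, ⟨by rw [mem_Ici]; linarith [hτ.1], hτU⟩, hreg.sq_mem_neumannSpectrum hroot⟩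

end ZeroPotential

end RootedMetricTree

/-! ### Asymptotics of eigenfunctions -/

theorem tendsto_integral_mul_cos {a : ℝ} (ha : 0 ≤ a) {q : ℝ → ℝ} (hq : IntegrableOn q (Icc 0 a)) :
    Tendsto (fun s : ℝ => ∫ t in (0 : ℝ)..a, q t * Real.cos (s * t)) atTop (𝓝 0) := by
  set f : ℝ → ℂ := (Ioc 0 a).indicator fun t => (q t : ℂ) with hf
  have hfi : Integrable f :=
    (integrable_indicator_iff measurableSet_Ioc).2 (hq.mono_set Ioc_subset_Icc_self).ofReal
  have hRL : Tendsto (fun s : ℝ => (∫ t, Real.fourierChar (-(t * (s / (2 * Real.pi)))) • f t).re)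
      atTop (𝓝 0) :=
    (Complex.continuous_re.tendsto 0).comp
      (((Real.tendsto_integral_exp_smul_cocompact f).mono_left atTop_le_cocompact).comp
        (tendsto_id.atTop_div_const Real.two_pi_pos))
  refine hRL.congr fun s => ?_
  have hint : Integrable fun t => Real.fourierChar (-(t * (s / (2 * Real.pi)))) • f t := by
    simpa [mul_comm] using
      (Real.fourierIntegral_convergent_iff (μ := volume) (f := f) (s / (2 * Real.pi))).2 hfi
  rw [← RCLike.re_eq_complex_re, ← integral_re hint, intervalIntegral.integral_of_le ha,
    ← integral_indicator measurableSet_Ioc]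
  congr 1 with t
  by_cases ht : t ∈ Ioc 0 a
  · rw [hf, indicator_of_mem ht, indicator_of_mem ht, RCLike.re_eq_complex_re, Circle.smul_def,
      Real.fourierChar_apply, smul_eq_mul, Complex.re_mul_ofReal, Complex.exp_ofReal_mul_I_re,
      mul_comm, ← Real.cos_neg]
    congr 2
    field_simp
  · simp [hf, indicator_of_notMem ht]

theorem tendsto_integral_mul_cos_sq {a : ℝ} (ha : 0 ≤ a) {q : ℝ → ℝ}
    (hq : IntegrableOn q (Icc 0 a)) :
    Tendsto (fun s : ℝ => ∫ t in (0 : ℝ)..a, q t * Real.cos (s * t) ^ 2) atTop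
      (𝓝 ((∫ t in (0 : ℝ)..a, q t) / 2)) := by
  have hqi : IntervalIntegrable q volume 0 a :=
    (intervalIntegrable_iff_integrableOn_Icc_of_le ha).2 hq
  have hcos := (tendsto_integral_mul_cos ha hq).comp (tendsto_id.const_mul_atTop two_pos)
  have h := (hcos.const_add (∫ t in (0 : ℝ)..a, q t)).div_const 2
  rw [add_zero] at h
  refine h.congr fun s => ?_
  rw [Function.comp_apply, ← intervalIntegral.integral_add hqi
    (hqi.mul_continuousOn (by fun_prop)), ← intervalIntegral.integral_div]
  congr 1 with t
  rw [Real.cos_sq, id, mul_assoc]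
  ring

theorem tendsto_integral_mul_of_tendstoUniformlyOn {ι : Type*} {L : Filter ι} {a : ℝ} (ha : 0 ≤ a)
    {q : ℝ → ℝ} (hq : IntegrableOn q (Icc 0 a)) {F : ι → ℝ → ℝ}
    (hF : TendstoUniformlyOn F 0 L (Icc 0 a)) :
    Tendsto (fun i => ∫ t in (0 : ℝ)..a, q t * F i t) L (𝓝 0) := by
  have hqi : IntervalIntegrable q volume 0 a :=
    (intervalIntegrable_iff_integrableOn_Icc_of_le ha).2 hq
  set K := ∫ t in (0 : ℝ)..a, |q t|
  have hK : 0 ≤ K := intervalIntegral.integral_nonneg ha fun t _ => abs_nonneg (q t)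
  rw [Metric.tendsto_nhds]
  intro ε hε
  filter_upwards [Metric.tendstoUniformlyOn_iff.1 hF (ε / (K + 1)) (by positivity)] with i hi
  rw [dist_zero_right]
  calc ‖∫ t in (0 : ℝ)..a, q t * F i t‖ ≤ ∫ t in (0 : ℝ)..a, |q t| * (ε / (K + 1)) := by
        refine intervalIntegral.norm_integral_le_of_norm_le ha (ae_of_all _ fun t ht => ?_)
          (hqi.abs.mul_const _)
        have := hi t (Ioc_subset_Icc_self ht)
        rw [Pi.zero_apply, dist_zero_left] at this
        rw [norm_mul]
        exact mul_le_mul_of_nonneg_left this.le (abs_nonneg _)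
    _ = K * ε / (K + 1) := by rw [intervalIntegral.integral_mul_const, mul_div_assoc]
    _ < ε := by
        rw [div_lt_iff₀ (by positivity)]
        linarith

namespace IsSturmLiouvilleSolution

variable {a s x : ℝ} {q y dy : ℝ → ℝ}

theorem abs_green_cos_le (ha : 0 ≤ a) (hq : IntegrableOn q (Icc 0 a))
    (hy : IsSturmLiouvilleSolution a q (s ^ 2) y dy) (hb : ∀ x ∈ Icc 0 a, |y x| ≤ 1)
    (hx : x ∈ Icc 0 a) (φ : ℝ) :
    |dy x * Real.cos (s * x - φ) + s * y x * Real.sin (s * x - φ) -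
      (dy 0 * Real.cos φ - s * y 0 * Real.sin φ)| ≤ ∫ t in (0 : ℝ)..a, |q t| := by
  have hqi : IntervalIntegrable q volume 0 a :=
    (intervalIntegrable_iff_integrableOn_Icc_of_le ha).2 hq
  have hgreen := hy.green ha
    (isSturmLiouvilleSolution_cos_add_sin a s (Real.cos φ) (Real.sin φ)) hx
  have hbound : ∀ t ∈ Ioc 0 x, ‖(q t - s ^ 2 - ((0 : ℝ → ℝ) t - s ^ 2)) * y t *
      (Real.cos φ * Real.cos (s * t) + Real.sin φ * Real.sin (s * t))‖ ≤ |q t| := by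
    intro t ht
    rw [← Real.cos_sub, Pi.zero_apply, sub_sub_sub_cancel_right, sub_zero, mul_assoc, norm_mul,
      norm_mul]
    exact mul_le_of_le_one_right (abs_nonneg _) (mul_le_one₀ (hb t ⟨ht.1.le, ht.2.trans hx.2⟩)
      (abs_nonneg _) (Real.abs_cos_le_one _))
  calc _ = ‖∫ t in (0 : ℝ)..x, (q t - s ^ 2 - ((0 : ℝ → ℝ) t - s ^ 2)) * y t *
        (Real.cos φ * Real.cos (s * t) + Real.sin φ * Real.sin (s * t))‖ := by
        rw [hgreen, Real.norm_eq_abs, Real.cos_sub, Real.sin_sub, mul_zero, Real.sin_zero,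
          Real.cos_zero]
        ring_nf
    _ ≤ ∫ t in (0 : ℝ)..x, |q t| :=
        intervalIntegral.norm_integral_le_of_norm_le hx.1 (ae_of_all _ hbound)
          (hqi.mono_set (uIcc_subset_uIcc_left (by rwa [uIcc_of_le ha]))).abs
    _ ≤ ∫ t in (0 : ℝ)..a, |q t| := intervalIntegral.integral_mono_interval le_rfl hx.1 hx.2
        (ae_of_all _ fun _ => abs_nonneg _) hqi.abs

theorem abs_sub_trig_le (ha : 0 ≤ a) (hs : 0 < s) (hq : IntegrableOn q (Icc 0 a))
    (hy : IsSturmLiouvilleSolution a q (s ^ 2) y dy) (hb : ∀ x ∈ Icc 0 a, |y x| ≤ 1)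
    (hx : x ∈ Icc 0 a) :
    |y x - (y 0 * Real.cos (s * x) + dy 0 / s * Real.sin (s * x))| ≤
      (∫ t in (0 : ℝ)..a, |q t|) / s := by
  have h := hy.abs_green_cos_le ha hq hb hx (s * x - Real.pi / 2)
  rw [sub_sub_cancel, Real.cos_pi_div_two, Real.sin_pi_div_two, Real.cos_sub_pi_div_two,
    Real.sin_sub_pi_div_two] at h
  rw [le_div_iff₀ hs, ← abs_of_pos hs, ← abs_mul, abs_of_pos hs]
  refine le_of_eq_of_le (congrArg abs ?_) h
  field_simp
  ring

theorem abs_deriv_sub_trig_le (ha : 0 ≤ a) (hs : 0 < s) (hq : IntegrableOn q (Icc 0 a))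
    (hy : IsSturmLiouvilleSolution a q (s ^ 2) y dy) (hb : ∀ x ∈ Icc 0 a, |y x| ≤ 1)
    (hx : x ∈ Icc 0 a) :
    |dy x / s - (dy 0 / s * Real.cos (s * x) - y 0 * Real.sin (s * x))| ≤
      (∫ t in (0 : ℝ)..a, |q t|) / s := by
  have h := hy.abs_green_cos_le ha hq hb hx (s * x)
  rw [sub_self, Real.cos_zero, Real.sin_zero] at h
  rw [le_div_iff₀ hs, ← abs_of_pos hs, ← abs_mul, abs_of_pos hs]
  refine le_of_eq_of_le (congrArg abs ?_) h
  field_simp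
  ring

end IsSturmLiouvilleSolution

theorem tendstoUniformlyOn_zero_of_abs_le {ι X : Type*} {L : Filter ι} {F G : ι → X → ℝ} {S : Set X}
    (hG : TendstoUniformlyOn G 0 L S) (h : ∀ᶠ i in L, ∀ x ∈ S, |F i x| ≤ |G i x|) :
    TendstoUniformlyOn F 0 L S := by
  rw [Metric.tendstoUniformlyOn_iff] at hG ⊢
  intro ε hε
  filter_upwards [hG ε hε, h] with i hi hFG x hx
  have := hi x hx
  rw [Pi.zero_apply, dist_zero_left, Real.norm_eq_abs] at this ⊢
  exact (hFG x hx).trans_lt this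

namespace RootedMetricTree

section Asymptotics

variable {V E : Type*} [Fintype E] [DecidableEq V] {T : RootedMetricTree V E}
  {Q Q' : E → ℝ → ℝ} {ι : Type*} {L : Filter ι} {s : ι → ℝ} {u w : ι → V → ℝ}
  {y dy z dz : ι → E → ℝ → ℝ}

/-- Eigenfunctions `y i`, normalized in the supremum norm and with values `u i` at the vertices,
for eigenvalues `s i ^ 2` tending to infinity in such a way that all phases tend to zero. -/
structure IsHighEnergyFamily (T : RootedMetricTree V E) (Q : E → ℝ → ℝ) (L : Filter ι) (s : ι → ℝ)
    (u : ι → V → ℝ) (y dy : ι → E → ℝ → ℝ) : Prop where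
  tendsto_atTop : Tendsto s L atTop
  tendsto_phase : Tendsto (fun i => T.phase (s i)) L (𝓝 0)
  solution : ∀ i, T.IsSolutionOffRoot Q (s i ^ 2) (u i) (y i) (dy i)
  flux_root : ∀ i, ∑ e with T.near e = T.root, dy i e (T.len e) = 0
  abs_le_one : ∀ i e, ∀ x ∈ Icc 0 (T.len e), |y i e x| ≤ 1
  exists_abs_eq_one : ∀ i, ∃ e, ∃ x ∈ Icc 0 (T.len e), |y i e x| = 1

theorem exists_normalized_of_mem_neumannSpectrum {lam : ℝ} (h : lam ∈ T.neumannSpectrum Q) :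
    ∃ y dy, T.IsNeumannSolution Q lam y dy ∧ (∀ e, ∀ x ∈ Icc 0 (T.len e), |y e x| ≤ 1) ∧
      ∃ e, ∃ x ∈ Icc 0 (T.len e), |y e x| = 1 := by
  obtain ⟨y, dy, hN, e₀, x₀, hx₀, hne⟩ := h
  have : Nonempty E := ⟨e₀⟩
  have hmax (e : E) : ∃ x ∈ Icc 0 (T.len e), ∀ x' ∈ Icc 0 (T.len e), |y e x'| ≤ |y e x| :=
    isCompact_Icc.exists_isMaxOn ⟨0, left_mem_Icc.2 (T.len_pos e).le⟩
      (hN.solution e).continuousOn.abs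
  choose X hX hXmax using hmax
  obtain ⟨e₁, he₁⟩ := Finite.exists_max fun e => |y e (X e)|
  have hb (e : E) {x : ℝ} (hx : x ∈ Icc 0 (T.len e)) : |y e x| ≤ |y e₁ (X e₁)| :=
    (hXmax e x hx).trans (he₁ e)
  have hpos : 0 < |y e₁ (X e₁)| := (abs_pos.2 hne).trans_le (hb e₀ hx₀)
  refine ⟨_, _, hN.const_mul |y e₁ (X e₁)|⁻¹, fun e x hx => ?_, e₁, X e₁, hX e₁, ?_⟩
  · rw [abs_mul, abs_inv, abs_abs, inv_mul_le_iff₀ hpos, mul_one]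
    exact hb e hx
  · rw [abs_mul, abs_inv, abs_abs, inv_mul_cancel₀ hpos.ne']

theorem exists_isHighEnergyFamily (hs : Tendsto s L atTop)
    (hphase : Tendsto (fun i => T.phase (s i)) L (𝓝 0))
    (hmem : ∀ i, s i ^ 2 ∈ T.neumannSpectrum Q) :
    ∃ u y dy, T.IsHighEnergyFamily Q L s u y dy := by
  choose y dy hN hle hone using fun i => exists_normalized_of_mem_neumannSpectrum (hmem i)
  choose hu hroot using fun i => (hN i).exists_isSolutionOffRoot
  choose u hu using hu
  exact ⟨u, y, dy, hs, hphase, hu, hroot, hle, hone⟩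

namespace IsHighEnergyFamily

theorem isNeumannSolution (h : T.IsHighEnergyFamily Q L s u y dy) (i : ι) :
    T.IsNeumannSolution Q (s i ^ 2) (y i) (dy i) :=
  (h.solution i).isNeumannSolution (h.flux_root i)

theorem tendsto_sin (h : T.IsHighEnergyFamily Q L s u y dy) (e : E) :
    Tendsto (fun i => Real.sin (s i * T.len e)) L (𝓝 0) := by
  simpa [phase, Function.comp_def] using
    (Real.Angle.continuous_sin.tendsto _).comp (tendsto_pi_nhds.1 h.tendsto_phase e)

theorem tendsto_cos (h : T.IsHighEnergyFamily Q L s u y dy) (e : E) :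
    Tendsto (fun i => Real.cos (s i * T.len e)) L (𝓝 1) := by
  simpa [phase, Function.comp_def] using
    (Real.Angle.continuous_cos.tendsto _).comp (tendsto_pi_nhds.1 h.tendsto_phase e)

theorem tendsto_mul_zero (h : T.IsHighEnergyFamily Q L s u y dy) (e : E) {g : ι → ℝ}
    (hg : Tendsto g L (𝓝 0)) : Tendsto (fun i => y i e 0 * g i) L (𝓝 0) :=
  isBoundedUnder_le_mul_tendsto_zero (isBoundedUnder_of
    ⟨1, fun i => h.abs_le_one i e 0 (left_mem_Icc.2 (T.len_pos e).le)⟩) hg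

theorem tendsto_flux (h : T.IsHighEnergyFamily Q L s u y dy)
    (hQ : ∀ e, IntegrableOn (Q e) (Icc 0 (T.len e))) (v : V) :
    Tendsto (fun i => (∑ e with T.near e = v, dy i e (T.len e)) / s i) L (𝓝 0) := by
  induction v using T.induction_up with
  | h v ih =>
  simp only [Finset.sum_div]
  rw [← Finset.sum_const_zero (s := Finset.univ.filter fun e => T.near e = v)]
  refine tendsto_finsetSum _ fun e he => ?_
  have hleft := ih e (Finset.mem_filter.1 he).2
  simp only [(h.solution _).kirchhoff] at hleft
  have herror : Tendsto (fun i => dy i e (T.len e) / s i - (dy i e 0 / s i *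
      Real.cos (s i * T.len e) - y i e 0 * Real.sin (s i * T.len e))) L (𝓝 0) := by
    refine squeeze_zero_norm' ?_ (h.tendsto_atTop.const_div_atTop (∫ t in (0)..T.len e, |Q e t|))
    filter_upwards [h.tendsto_atTop.eventually_gt_atTop 0] with i hi
    exact ((h.solution i).solution e).abs_deriv_sub_trig_le (T.len_pos e).le hi (hQ e)
      (h.abs_le_one i e) (right_mem_Icc.2 (T.len_pos e).le)
  simpa using herror.add
    ((hleft.mul (h.tendsto_cos e)).sub (h.tendsto_mul_zero e (h.tendsto_sin e)))

theorem tendsto_deriv_zero (h : T.IsHighEnergyFamily Q L s u y dy)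
    (hQ : ∀ e, IntegrableOn (Q e) (Icc 0 (T.len e))) (e : E) :
    Tendsto (fun i => dy i e 0 / s i) L (𝓝 0) := by
  simpa only [(h.solution _).kirchhoff] using h.tendsto_flux hQ (T.far e)

theorem tendstoUniformlyOn_sub_trig (h : T.IsHighEnergyFamily Q L s u y dy)
    (hQ : ∀ e, IntegrableOn (Q e) (Icc 0 (T.len e))) (e : E) :
    TendstoUniformlyOn (fun i x => y i e x - y i e 0 * Real.cos (s i * x)) 0 L
      (Icc 0 (T.len e)) := by
  have herror : TendstoUniformlyOn (fun i x => y i e x -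
      (y i e 0 * Real.cos (s i * x) + dy i e 0 / s i * Real.sin (s i * x))) 0 L
      (Icc 0 (T.len e)) := by
    refine tendstoUniformlyOn_zero_of_abs_le ((h.tendsto_atTop.const_div_atTop
      (∫ t in (0)..T.len e, |Q e t|)).tendstoUniformlyOn_const _) ?_
    filter_upwards [h.tendsto_atTop.eventually_gt_atTop 0] with i hi x hx
    exact (((h.solution i).solution e).abs_sub_trig_le (T.len_pos e).le hi (hQ e)
      (h.abs_le_one i e) hx).trans (le_abs_self _)
  have hsin : TendstoUniformlyOn (fun i x => dy i e 0 / s i * Real.sin (s i * x)) 0 L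
      (Icc 0 (T.len e)) := by
    refine tendstoUniformlyOn_zero_of_abs_le
      ((h.tendsto_deriv_zero hQ e).tendstoUniformlyOn_const _) (.of_forall fun i x _ => ?_)
    rw [abs_mul]
    exact mul_le_of_le_one_right (abs_nonneg _) (Real.abs_sin_le_one _)
  refine ((herror.add hsin).congr (.of_forall fun i x _ => ?_)).congr_right fun x _ => ?_
  · simp only [Pi.add_apply]
    ring
  · simp only [Pi.add_apply, Pi.zero_apply, add_zero]

theorem tendsto_sub_root (h : T.IsHighEnergyFamily Q L s u y dy)
    (hQ : ∀ e, IntegrableOn (Q e) (Icc 0 (T.len e))) (v : V) :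
    Tendsto (fun i => u i v - u i T.root) L (𝓝 0) := by
  induction v using T.induction_down with
  | h₀ => simp only [sub_self, tendsto_const_nhds]
  | h e ih =>
  have hlen := (h.tendstoUniformlyOn_sub_trig hQ e).tendsto_at (right_mem_Icc.2 (T.len_pos e).le)
  have hcos := h.tendsto_mul_zero e (by simpa using (h.tendsto_cos e).sub_const 1)
  refine Tendsto.congr (fun i => ?_) (by simpa using ih.sub (hlen.add hcos))
  rw [(h.solution i).apply_len, (h.solution i).apply_zero]
  ring

theorem tendstoUniformlyOn_sub_root_mul_cos (h : T.IsHighEnergyFamily Q L s u y dy)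
    (hQ : ∀ e, IntegrableOn (Q e) (Icc 0 (T.len e))) (e : E) :
    TendstoUniformlyOn (fun i x => y i e x - u i T.root * Real.cos (s i * x)) 0 L
      (Icc 0 (T.len e)) := by
  have hcos : TendstoUniformlyOn
      (fun i x => (u i (T.far e) - u i T.root) * Real.cos (s i * x)) 0 L (Icc 0 (T.len e)) := by
    refine tendstoUniformlyOn_zero_of_abs_le
      ((h.tendsto_sub_root hQ (T.far e)).tendstoUniformlyOn_const _) (.of_forall fun i x _ => ?_)
    rw [abs_mul]
    exact mul_le_of_le_one_right (abs_nonneg _) (Real.abs_cos_le_one _)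
  refine (((h.tendstoUniformlyOn_sub_trig hQ e).add hcos).congr
    (.of_forall fun i x _ => ?_)).congr_right fun x _ => ?_
  · simp only [Pi.add_apply, (h.solution i).apply_zero]
    ring
  · simp only [Pi.add_apply, Pi.zero_apply, add_zero]

theorem eventually_half_le_abs_root (h : T.IsHighEnergyFamily Q L s u y dy)
    (hQ : ∀ e, IntegrableOn (Q e) (Icc 0 (T.len e))) : ∀ᶠ i in L, 1 / 2 ≤ |u i T.root| := by
  have hclose := eventually_all.2 fun e => Metric.tendstoUniformlyOn_iff.1
    (h.tendstoUniformlyOn_sub_root_mul_cos hQ e) (1 / 2) one_half_pos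
  filter_upwards [hclose] with i hi
  obtain ⟨e, x, hx, hone⟩ := h.exists_abs_eq_one i
  have hsub := hi e x hx
  rw [Pi.zero_apply, dist_zero_left, Real.norm_eq_abs] at hsub
  have hle := abs_sub_abs_le_abs_sub (y i e x) (u i T.root * Real.cos (s i * x))
  rw [hone, abs_mul] at hle
  linarith [mul_le_of_le_one_right (abs_nonneg (u i T.root)) (Real.abs_cos_le_one (s i * x))]

theorem abs_root_le_one (h : T.IsHighEnergyFamily Q L s u y dy) (i : ι) : |u i T.root| ≤ 1 := by
  obtain ⟨e₀, -⟩ := h.exists_abs_eq_one i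
  have : Nonempty E := ⟨e₀⟩
  obtain ⟨e, he⟩ := T.exists_near_eq_root
  rw [← he, ← (h.solution i).apply_len]
  exact h.abs_le_one i e _ (right_mem_Icc.2 (T.len_pos e).le)

theorem tendstoUniformlyOn_mul_sub (hy : T.IsHighEnergyFamily Q L s u y dy)
    (hz : T.IsHighEnergyFamily Q' L s w z dz) (hQ : ∀ e, IntegrableOn (Q e) (Icc 0 (T.len e)))
    (hQ' : ∀ e, IntegrableOn (Q' e) (Icc 0 (T.len e))) (e : E) :
    TendstoUniformlyOn (fun i x => y i e x * z i e x -
      u i T.root * w i T.root * Real.cos (s i * x) ^ 2) 0 L (Icc 0 (T.len e)) := by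
  have hleft : TendstoUniformlyOn (fun i x => (y i e x - u i T.root * Real.cos (s i * x)) *
      z i e x) 0 L (Icc 0 (T.len e)) := by
    refine tendstoUniformlyOn_zero_of_abs_le (hy.tendstoUniformlyOn_sub_root_mul_cos hQ e)
      (.of_forall fun i x hx => ?_)
    rw [abs_mul]
    exact mul_le_of_le_one_right (abs_nonneg _) (hz.abs_le_one i e x hx)
  have hright : TendstoUniformlyOn (fun i x => u i T.root * Real.cos (s i * x) *
      (z i e x - w i T.root * Real.cos (s i * x))) 0 L (Icc 0 (T.len e)) := by
    refine tendstoUniformlyOn_zero_of_abs_le (hz.tendstoUniformlyOn_sub_root_mul_cos hQ' e)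
      (.of_forall fun i x _ => ?_)
    rw [abs_mul, abs_mul]
    exact mul_le_of_le_one_left (abs_nonneg _)
      (mul_le_one₀ (hy.abs_root_le_one i) (abs_nonneg _) (Real.abs_cos_le_one _))
  refine ((hleft.add hright).congr (.of_forall fun i x _ => ?_)).congr_right fun x _ => ?_
  · simp only [Pi.add_apply]
    ring
  · simp only [Pi.add_apply, Pi.zero_apply, add_zero]

theorem tendsto_sum_integral_mul_cos_sq_zero (hy : T.IsHighEnergyFamily Q L s u y dy)
    (hz : T.IsHighEnergyFamily 0 L s w z dz) (hQ : ∀ e, IntegrableOn (Q e) (Icc 0 (T.len e))) :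
    Tendsto (fun i => ∑ e, ∫ t in (0)..T.len e, Q e t * Real.cos (s i * t) ^ 2) L (𝓝 0) := by
  have hqi (e : E) : IntervalIntegrable (Q e) volume 0 (T.len e) :=
    (intervalIntegrable_iff_integrableOn_Icc_of_le (T.len_pos e).le).2 (hQ e)
  have hprod : Tendsto (fun i => u i T.root * w i T.root *
      ∑ e, ∫ t in (0)..T.len e, Q e t * Real.cos (s i * t) ^ 2) L (𝓝 0) := by
    have hsum := tendsto_finsetSum Finset.univ fun e _ =>
      tendsto_integral_mul_of_tendstoUniformlyOn (T.len_pos e).le (hQ e)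
        (hy.tendstoUniformlyOn_mul_sub hz hQ (fun _ => integrableOn_zero) e)
    rw [Finset.sum_const_zero] at hsum
    refine (neg_zero (G := ℝ) ▸ hsum.neg).congr fun i => ?_
    have horth := (hy.isNeumannSolution i).sum_integral_mul_eq_zero (hz.isNeumannSolution i)
    simp only [Pi.zero_apply, sub_sub_sub_cancel_right, sub_zero, mul_assoc] at horth
    have hsplit (e : E) : ∫ t in (0)..T.len e, Q e t * (y i e t * z i e t -
        u i T.root * w i T.root * Real.cos (s i * t) ^ 2) =
        (∫ t in (0)..T.len e, Q e t * (y i e t * z i e t)) -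
          u i T.root * w i T.root * ∫ t in (0)..T.len e, Q e t * Real.cos (s i * t) ^ 2 := by
      have hyz : ContinuousOn (fun t => y i e t * z i e t) (uIcc 0 (T.len e)) := by
        rw [uIcc_of_le (T.len_pos e).le]
        exact ((hy.solution i).solution e).continuousOn.mul
          ((hz.solution i).solution e).continuousOn
      have hcos : ContinuousOn (fun t => Real.cos (s i * t) ^ 2) (uIcc 0 (T.len e)) := by fun_prop
      rw [← intervalIntegral.integral_const_mul, ← intervalIntegral.integral_sub
        ((hqi e).mul_continuousOn hyz) (((hqi e).mul_continuousOn hcos).const_mul _)]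
      congr 1 with t
      ring
    simp only [hsplit, Finset.sum_sub_distrib, horth, zero_sub, neg_neg, Finset.mul_sum]
  refine squeeze_zero_norm' ?_ (by simpa using hprod.norm.const_mul 4)
  filter_upwards [hy.eventually_half_le_abs_root hQ,
    hz.eventually_half_le_abs_root fun _ => integrableOn_zero] with i hu hw
  rw [← mul_assoc, Real.norm_eq_abs]
  exact le_mul_of_one_le_left (abs_nonneg _) (by nlinarith)

end IsHighEnergyFamily

theorem sum_integral_eq_zero_of_neumannSpectrum_zero_subset [Nonempty E]
    (hQ : ∀ e, IntegrableOn (Q e) (Icc 0 (T.len e)))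
    (hsub : T.neumannSpectrum 0 ⊆ T.neumannSpectrum Q) : ∑ e, ∫ t in (0)..T.len e, Q e t = 0 := by
  let s : {s : ℝ // s ^ 2 ∈ T.neumannSpectrum 0} → ℝ := Subtype.val
  let L := comap s (atTop ⊓ comap T.phase (𝓝 0))
  have : L.NeBot := comap_neBot_iff_frequently.2 <|
    T.frequently_sq_mem_neumannSpectrum_zero.mono fun s hs => ⟨⟨s, hs⟩, rfl⟩
  have hs : Tendsto s L atTop := tendsto_comap.mono_right inf_le_left
  have hphase : Tendsto (fun i => T.phase (s i)) L (𝓝 0) :=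
    tendsto_comap.comp (tendsto_comap.mono_right inf_le_right)
  obtain ⟨u, y, dy, hy⟩ := exists_isHighEnergyFamily hs hphase fun i => hsub i.2
  obtain ⟨w, z, dz, hz⟩ := exists_isHighEnergyFamily hs hphase fun i => i.2
  have hlim := tendsto_finsetSum Finset.univ fun e _ =>
    (tendsto_integral_mul_cos_sq (T.len_pos e).le (hQ e)).comp hs
  have := tendsto_nhds_unique hlim (hy.tendsto_sum_integral_mul_cos_sq_zero hz hQ)
  rw [← Finset.sum_div] at this
  linarith

end Asymptotics

end RootedMetricTree

/-! ### Positive supersolutions -/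

namespace RootedMetricTree

section Supersolution

variable {V E : Type*} [Fintype E] [DecidableEq V] {T : RootedMetricTree V E}
  {Q : E → ℝ → ℝ} {lam : ℝ} {u : V → ℝ} {y dy : E → ℝ → ℝ}

/-- `y` is nonnegative and satisfies every condition of `IsNeumannSolution`, except that the flux
into the root is only required to be nonnegative. The existence of such a `y ≠ 0` expresses that
`lam` does not exceed the lowest eigenvalue. -/
structure IsRootSupersolution (T : RootedMetricTree V E) (Q : E → ℝ → ℝ) (lam : ℝ) (u : V → ℝ)
    (y dy : E → ℝ → ℝ) : Prop extends T.IsSolutionOffRoot Q lam u y dy where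
  nonneg : ∀ e, ∀ x ∈ Icc 0 (T.len e), 0 ≤ y e x
  flux_nonneg : 0 ≤ ∑ e with T.near e = T.root, dy e (T.len e)

namespace IsRootSupersolution

theorem const_mul (h : T.IsRootSupersolution Q lam u y dy) {c : ℝ} (hc : 0 ≤ c) :
    T.IsRootSupersolution Q lam (c • u) (fun e x => c * y e x) (fun e x => c * dy e x) where
  solution e := (h.solution e).const_mul c
  apply_zero e := by rw [h.apply_zero, Pi.smul_apply, smul_eq_mul]
  apply_len e := by rw [h.apply_len, Pi.smul_apply, smul_eq_mul]
  kirchhoff e := by rw [← Finset.mul_sum, h.kirchhoff]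
  nonneg e x hx := mul_nonneg hc (h.nonneg e x hx)
  flux_nonneg := by
    rw [← Finset.mul_sum]
    exact mul_nonneg hc h.flux_nonneg

theorem deriv_len_nonpos (h : T.IsRootSupersolution Q lam u y dy) {e : E}
    (he : u (T.near e) = 0) : dy e (T.len e) ≤ 0 :=
  nonpos_of_hasDerivWithinAt_right (T.len_pos e)
    ((h.solution e).hasDerivWithinAt _ (right_mem_Icc.2 (T.len_pos e).le)) fun x hx => by
      rw [h.apply_len, he]
      exact h.nonneg e x hx

theorem deriv_zero_nonneg (h : T.IsRootSupersolution Q lam u y dy) {e : E}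
    (he : u (T.far e) = 0) : 0 ≤ dy e 0 :=
  nonneg_of_hasDerivWithinAt_left (T.len_pos e)
    ((h.solution e).hasDerivWithinAt _ (left_mem_Icc.2 (T.len_pos e).le)) fun x hx => by
      rw [h.apply_zero, he]
      exact h.nonneg e x hx

theorem sum_deriv_len_eq_zero (h : T.IsRootSupersolution Q lam u y dy) {v : V} (hv : u v = 0) :
    ∑ e with T.near e = v, dy e (T.len e) = 0 := by
  refine le_antisymm (Finset.sum_nonpos fun e he => h.deriv_len_nonpos ?_) ?_
  · rw [(Finset.mem_filter.1 he).2, hv]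
  · by_cases hroot : v = T.root
    · exact hroot ▸ h.flux_nonneg
    · obtain ⟨e, rfl⟩ := T.exists_far_eq hroot
      exact (h.kirchhoff e).symm ▸ h.deriv_zero_nonneg hv

theorem eq_zero_of_near (hQ : ∀ e, IntegrableOn (Q e) (Icc 0 (T.len e)))
    (h : T.IsRootSupersolution Q lam u y dy) {e : E} (he : u (T.near e) = 0) :
    ∀ x ∈ Icc 0 (T.len e), y e x = 0 ∧ dy e x = 0 := by
  have hderiv : ∀ e' ∈ Finset.univ.filter fun e' => T.near e' = T.near e, dy e' (T.len e') ≤ 0 :=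
    fun e' he' => h.deriv_len_nonpos (by rw [(Finset.mem_filter.1 he').2, he])
  exact (h.solution e).eq_zero_of_initial (T.len_pos e).le (hQ e) (right_mem_Icc.2 (T.len_pos e).le)
    ((h.apply_len e).trans he) ((Finset.sum_eq_zero_iff_of_nonpos hderiv).1
      (h.sum_deriv_len_eq_zero he) e (Finset.mem_filter.2 ⟨Finset.mem_univ e, rfl⟩))

theorem eq_zero_of_far (hQ : ∀ e, IntegrableOn (Q e) (Icc 0 (T.len e)))
    (h : T.IsRootSupersolution Q lam u y dy) {e : E} (he : u (T.far e) = 0) :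
    ∀ x ∈ Icc 0 (T.len e), y e x = 0 ∧ dy e x = 0 :=
  (h.solution e).eq_zero_of_initial (T.len_pos e).le (hQ e) (left_mem_Icc.2 (T.len_pos e).le)
    ((h.apply_zero e).trans he) ((h.kirchhoff e).symm.trans (h.sum_deriv_len_eq_zero he))

theorem apply_eq_zero_iff (hQ : ∀ e, IntegrableOn (Q e) (Icc 0 (T.len e)))
    (h : T.IsRootSupersolution Q lam u y dy) (v : V) : u v = 0 ↔ u T.root = 0 := by
  induction v using T.induction_down with
  | h₀ => rfl
  | h e ih =>
    rw [← ih]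
    constructor <;> intro he
    · rw [← h.apply_len]
      exact (h.eq_zero_of_far hQ he _ (right_mem_Icc.2 (T.len_pos e).le)).1
    · rw [← h.apply_zero]
      exact (h.eq_zero_of_near hQ he _ (left_mem_Icc.2 (T.len_pos e).le)).1

theorem pos (hQ : ∀ e, IntegrableOn (Q e) (Icc 0 (T.len e)))
    (h : T.IsRootSupersolution Q lam u y dy) (hroot : u T.root ≠ 0) {e : E} {x : ℝ}
    (hx : x ∈ Icc 0 (T.len e)) : 0 < y e x := by
  have hu (v : V) : u v ≠ 0 := mt (h.apply_eq_zero_iff hQ v).1 hroot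
  refine (h.nonneg e x hx).lt_of_ne' fun hyx => ?_
  rcases eq_endpoints_or_mem_Ioo_of_mem_Icc hx with rfl | rfl | hx
  · exact hu _ ((h.apply_zero e).symm.trans hyx)
  · exact hu _ ((h.apply_len e).symm.trans hyx)
  · refine hu (T.far e) ?_
    rw [← h.apply_zero]
    exact ((h.solution e).eq_zero_of_nonneg_of_eq_zero (hQ e) (h.nonneg e) hx hyx 0
      (left_mem_Icc.2 (T.len_pos e).le)).1

theorem root_pos [Nonempty E] (h : T.IsRootSupersolution Q lam u y dy) (hroot : u T.root ≠ 0) :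
    0 < u T.root := by
  obtain ⟨e, he⟩ := T.exists_near_eq_root
  refine hroot.lt_of_le' ?_
  rw [← he, ← h.apply_len]
  exact h.nonneg e _ (right_mem_Icc.2 (T.len_pos e).le)

theorem continuousOn_sq_logDeriv (hQ : ∀ e, IntegrableOn (Q e) (Icc 0 (T.len e)))
    (h : T.IsRootSupersolution Q lam u y dy) (hroot : u T.root ≠ 0) (e : E) :
    ContinuousOn (fun t => (dy e t / y e t) ^ 2) (Icc 0 (T.len e)) :=
  (((h.solution e).continuousOn_deriv (T.len_pos e).le).div
    (h.solution e).continuousOn fun _ hx => (h.pos hQ hroot hx).ne').pow 2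

-- Integrate the Riccati equation for the logarithmic derivative of `y` over the tree.
theorem sum_integral_sq_logDeriv_le (hQ : ∀ e, IntegrableOn (Q e) (Icc 0 (T.len e)))
    (h : T.IsRootSupersolution Q 0 u y dy) (hroot : 0 < u T.root) :
    ∑ e, ∫ t in (0)..T.len e, (dy e t / y e t) ^ 2 ≤ ∑ e, ∫ t in (0)..T.len e, Q e t := by
  have := T.finite_vertices
  have := Fintype.ofFinite V
  have hriccati (e : E) : (∫ t in (0)..T.len e, Q e t) -
      ∫ t in (0)..T.len e, (dy e t / y e t) ^ 2 =
        dy e (T.len e) * (u (T.near e))⁻¹ - dy e 0 * (u (T.far e))⁻¹ := by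
    have hlogDeriv := h.continuousOn_sq_logDeriv hQ hroot.ne' e
    rw [← uIcc_of_le (T.len_pos e).le] at hlogDeriv
    rw [← intervalIntegral.integral_sub ((intervalIntegrable_iff_integrableOn_Icc_of_le
      (T.len_pos e).le).2 (hQ e)) hlogDeriv.intervalIntegrable, ← h.apply_zero, ← h.apply_len,
      ← div_eq_mul_inv, ← div_eq_mul_inv, ← (h.solution e).riccati (T.len_pos e).le
        fun x hx => h.pos hQ hroot.ne' hx]
    simp only [sub_zero]
  rw [← sub_nonneg, ← Finset.sum_sub_distrib, Finset.sum_congr rfl fun e _ => hriccati e,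
    T.sum_edges_eq_sum_vertices (fun e => dy e (T.len e)) (fun e => dy e 0) fun v => (u v)⁻¹]
  refine Finset.sum_nonneg fun v _ => ?_
  by_cases hv : v = T.root
  · rw [hv, T.filter_far_root, Finset.sum_empty, sub_zero]
    exact mul_nonneg (inv_nonneg.2 hroot.le) h.flux_nonneg
  · obtain ⟨e, rfl⟩ := T.exists_far_eq hv
    rw [h.kirchhoff, T.filter_far_eq, Finset.sum_singleton, sub_self, mul_zero]

theorem deriv_eq_zero (hQ : ∀ e, IntegrableOn (Q e) (Icc 0 (T.len e)))
    (hsum : ∑ e, ∫ t in (0)..T.len e, Q e t ≤ 0) (h : T.IsRootSupersolution Q 0 u y dy)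
    (hroot : 0 < u T.root) {e : E} {x : ℝ} (hx : x ∈ Icc 0 (T.len e)) : dy e x = 0 := by
  have hnonneg : ∀ e ∈ Finset.univ, 0 ≤ ∫ t in (0)..T.len e, (dy e t / y e t) ^ 2 := fun e _ =>
    intervalIntegral.integral_nonneg (T.len_pos e).le fun _ _ => sq_nonneg _
  have hzero := (Finset.sum_eq_zero_iff_of_nonneg hnonneg).1 (le_antisymm
    ((h.sum_integral_sq_logDeriv_le hQ hroot).trans hsum) (Finset.sum_nonneg hnonneg)) e
      (Finset.mem_univ e)
  have hlogDeriv : (dy e x / y e x) ^ 2 = 0 :=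
    eqOn_zero_of_intervalIntegral_eq_zero (T.len_pos e) (h.continuousOn_sq_logDeriv hQ hroot.ne' e)
      (fun _ _ => sq_nonneg _) hzero hx
  exact (div_eq_zero_iff.1 (pow_eq_zero_iff two_ne_zero |>.1 hlogDeriv)).resolve_right
    (h.pos hQ hroot.ne' hx).ne'

theorem ae_eq_zero (hQ : ∀ e, IntegrableOn (Q e) (Icc 0 (T.len e)))
    (hsum : ∑ e, ∫ t in (0)..T.len e, Q e t ≤ 0) (h : T.IsRootSupersolution Q 0 u y dy)
    (hroot : 0 < u T.root) (e : E) : ∀ᵐ x ∂(volume.restrict (Icc 0 (T.len e))), Q e x = 0 := by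
  rw [← Measure.restrict_congr_set Ioo_ae_eq_Icc]
  filter_upwards [(h.solution e).ae_hasDerivAt, ae_restrict_mem measurableSet_Ioo]
    with x hderiv hx
  have hdy₀ : HasDerivAt (dy e) 0 x := (hasDerivAt_const x 0).congr_of_eventuallyEq <| by
    filter_upwards [Icc_mem_nhds hx.1 hx.2] with t ht using h.deriv_eq_zero hQ hsum hroot ht
  have hmul := hderiv.2.unique hdy₀
  rw [sub_zero] at hmul
  exact (mul_eq_zero.1 hmul).resolve_right (h.pos hQ hroot.ne' (Ioo_subset_Icc_self hx)).ne'

end IsRootSupersolution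

theorem IsNeumannSolution.sum_energy_eq_zero (h : T.IsNeumannSolution Q lam y dy) :
    ∑ e, ∫ t in (0)..T.len e, (dy e t ^ 2 + (Q e t - lam) * y e t ^ 2) = 0 := by
  have := T.finite_vertices
  have := Fintype.ofFinite V
  obtain ⟨u, hu⟩ := h.continuity
  simp only [(h.solution _).energy (T.len_pos _).le, (hu _).1, (hu _).2,
    T.sum_edges_eq_sum_vertices (fun e => dy e (T.len e)) (fun e => dy e 0), h.kirchhoff, sub_self,
    mul_zero, Finset.sum_const_zero]

theorem nonneg_of_mem_neumannSpectrum_zero (hlam : lam ∈ T.neumannSpectrum 0) : 0 ≤ lam := by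
  obtain ⟨y, dy, h, e, x, hx, hne⟩ := hlam
  by_contra! hneg
  have hnonneg (e : E) (t : ℝ) : 0 ≤ dy e t ^ 2 + (0 - lam) * y e t ^ 2 :=
    add_nonneg (sq_nonneg _) (mul_nonneg (by linarith) (sq_nonneg _))
  have hzero := (Finset.sum_eq_zero_iff_of_nonneg fun e _ =>
    intervalIntegral.integral_nonneg (T.len_pos e).le fun t _ => hnonneg e t).1
      h.sum_energy_eq_zero e (Finset.mem_univ e)
  have hcont := (((h.solution e).continuousOn_deriv (T.len_pos e).le).pow 2).add
    (continuousOn_const (c := 0 - lam) |>.mul ((h.solution e).continuousOn.pow 2))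
  have henergy : dy e x ^ 2 + (0 - lam) * y e x ^ 2 = 0 :=
    eqOn_zero_of_intervalIntegral_eq_zero (T.len_pos e) hcont (fun t _ => hnonneg e t) hzero hx
  have : 0 < (0 - lam) * y e x ^ 2 := mul_pos (by linarith) (by positivity)
  linarith [sq_nonneg (dy e x)]

end Supersolution

end RootedMetricTree

/-! ### The ground state -/

theorem IsSolutionOperator.eq_mul {a : ℝ} {q : ℝ → ℝ} {Φ Φ' : ℝ → ℝ × ℝ → ℝ → ℝ}
    (hΦ : IsSolutionOperator a q Φ Φ') (ha : 0 ≤ a) (hq : IntegrableOn q (Icc 0 a)) {lam r : ℝ}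
    {y dy : ℝ → ℝ} (hy : IsSturmLiouvilleSolution a q lam y dy) (h : dy 0 = y 0 * r) :
    ∀ x ∈ Icc 0 a, y x = y 0 * Φ lam (1, r) x ∧ dy x = y 0 * Φ' lam (1, r) x :=
  hy.eq_of_initial ha hq ((hΦ.solution lam (1, r)).const_mul (y 0))
    (by rw [hΦ.apply_zero, mul_one]) (by rw [hΦ.deriv_zero, h])

namespace RootedMetricTree

section GroundState

variable {V E : Type*} [Fintype E] [DecidableEq V] {T : RootedMetricTree V E}
  {Q : E → ℝ → ℝ} {lam : ℝ} {u : V → ℝ} {y dy : E → ℝ → ℝ} {Φ Φ' : E → ℝ → ℝ × ℝ → ℝ → ℝ}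

/-- Spectral parameter, values at the vertices and derivatives at the far ends of the edges of the
root supersolutions. These data determine the supersolution. -/
def rootSupersolutionData (T : RootedMetricTree V E) (Q : E → ℝ → ℝ) :
    Set (ℝ × (V → ℝ) × (E → ℝ)) :=
  {z | ∃ y dy, T.IsRootSupersolution Q z.1 z.2.1 y dy ∧ ∀ e, dy e 0 = z.2.2 e}

/-- The spectral parameters that admit a positive root supersolution. -/
def positiveParameters (T : RootedMetricTree V E) (Q : E → ℝ → ℝ) : Set ℝ :=
  {lam | ∃ u y dy, T.IsRootSupersolution Q lam u y dy ∧ 0 < u T.root}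

theorem mem_rootSupersolutionData_iff (hQ : ∀ e, IntegrableOn (Q e) (Icc 0 (T.len e)))
    (hΦ : ∀ e, IsSolutionOperator (T.len e) (Q e) (Φ e) (Φ' e)) {z : ℝ × (V → ℝ) × (E → ℝ)} :
    z ∈ T.rootSupersolutionData Q ↔
      (∀ e, Φ e z.1 (z.2.1 (T.far e), z.2.2 e) (T.len e) = z.2.1 (T.near e)) ∧
      (∀ e, ∑ e' with T.near e' = T.far e, Φ' e' z.1 (z.2.1 (T.far e'), z.2.2 e') (T.len e') =
        z.2.2 e) ∧
      (∀ e, ∀ x ∈ Icc 0 (T.len e), 0 ≤ Φ e z.1 (z.2.1 (T.far e), z.2.2 e) x) ∧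
      0 ≤ ∑ e with T.near e = T.root, Φ' e z.1 (z.2.1 (T.far e), z.2.2 e) (T.len e) := by
  constructor
  · rintro ⟨y, dy, h, hb⟩
    have heq (e : E) : ∀ x ∈ Icc 0 (T.len e), y e x = Φ e z.1 (z.2.1 (T.far e), z.2.2 e) x ∧
        dy e x = Φ' e z.1 (z.2.1 (T.far e), z.2.2 e) x :=
      (h.solution e).eq_of_initial (T.len_pos e).le (hQ e) ((hΦ e).solution _ _)
        (by rw [(hΦ e).apply_zero, h.apply_zero]) (by rw [(hΦ e).deriv_zero, hb])
    have hlen (e : E) := heq e _ (right_mem_Icc.2 (T.len_pos e).le)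
    simp only [← (hlen _).1, ← (hlen _).2]
    exact ⟨h.apply_len, fun e => (h.kirchhoff e).trans (hb e),
      fun e x hx => (heq e x hx).1 ▸ h.nonneg e x hx, h.flux_nonneg⟩
  · rintro ⟨hlen, hkirchhoff, hnonneg, hflux⟩
    exact ⟨_, _, ⟨⟨fun e => (hΦ e).solution _ _, fun e => (hΦ e).apply_zero _ _, hlen,
      fun e => (hkirchhoff e).trans ((hΦ e).deriv_zero _ (_, z.2.2 e)).symm⟩, hnonneg, hflux⟩,
      fun e => (hΦ e).deriv_zero _ _⟩

theorem isClosed_rootSupersolutionData (hQ : ∀ e, IntegrableOn (Q e) (Icc 0 (T.len e))) :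
    IsClosed (T.rootSupersolutionData Q) := by
  choose Φ Φ' hΦ using fun e => exists_isSolutionOperator (T.len_pos e).le (hQ e)
  have hval (e : E) (x : ℝ) : Continuous fun z : ℝ × (V → ℝ) × (E → ℝ) =>
      Φ e z.1 (z.2.1 (T.far e), z.2.2 e) x :=
    (hΦ e).continuous.comp
      (f := fun z : ℝ × (V → ℝ) × (E → ℝ) => (z.1, (z.2.1 (T.far e), z.2.2 e), x)) (by fun_prop)
  have hderiv (e : E) (x : ℝ) : Continuous fun z : ℝ × (V → ℝ) × (E → ℝ) =>
      Φ' e z.1 (z.2.1 (T.far e), z.2.2 e) x :=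
    (hΦ e).continuous_deriv.comp
      (f := fun z : ℝ × (V → ℝ) × (E → ℝ) => (z.1, (z.2.1 (T.far e), z.2.2 e), x)) (by fun_prop)
  have hflux (v : V) := continuous_finsetSum (Finset.univ.filter fun e => T.near e = v)
    fun e _ => hderiv e (T.len e)
  rw [← ofPred_mem_eq (s := T.rootSupersolutionData Q)]
  simp only [mem_rootSupersolutionData_iff hQ hΦ, ofPred_and, ofPred_forall]
  exact (isClosed_iInter fun e => isClosed_eq (hval e _) (by fun_prop)).inter <|
    (isClosed_iInter fun e => isClosed_eq (hflux _) (by fun_prop)).inter <|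
    (isClosed_iInter fun e => isClosed_iInter fun x => isClosed_iInter fun _ =>
      isClosed_le continuous_const (hval e x)).inter <|
    isClosed_le continuous_const (hflux _)

theorem positiveParameters_eq_image [Fintype V] [Nonempty E]
    (hQ : ∀ e, IntegrableOn (Q e) (Icc 0 (T.len e))) :
    T.positiveParameters Q =
      Prod.fst '' (T.rootSupersolutionData Q ∩ Prod.snd ⁻¹' Metric.sphere 0 1) := by
  ext lam
  constructor
  · rintro ⟨u, y, dy, h, hroot⟩
    let w : (V → ℝ) × (E → ℝ) := (u, fun e => dy e 0)
    have hw : w ≠ 0 := fun hw => hroot.ne' (congrFun (congrArg Prod.fst hw) T.root)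
    refine ⟨(lam, ‖w‖⁻¹ • w), ⟨⟨_, _, h.const_mul (inv_nonneg.2 (norm_nonneg w)), fun e => rfl⟩,
      ?_⟩, rfl⟩
    rw [mem_preimage, mem_sphere_zero_iff_norm, norm_smul, norm_inv, norm_norm,
      inv_mul_cancel₀ (norm_ne_zero_iff.2 hw)]
  · rintro ⟨⟨lam, u, b⟩, ⟨⟨y, dy, h, hb⟩, hw⟩, rfl⟩
    refine ⟨u, y, dy, h, h.root_pos fun hroot => ?_⟩
    have hu (v : V) : u v = 0 := (h.apply_eq_zero_iff hQ v).2 hroot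
    have hb₀ (e : E) : b e = 0 :=
      (hb e).symm.trans (h.eq_zero_of_far hQ (hu _) 0 (left_mem_Icc.2 (T.len_pos e).le)).2
    rw [mem_preimage, mem_sphere_zero_iff_norm,
      show (u, b) = 0 from Prod.ext (funext hu) (funext hb₀), norm_zero] at hw
    exact zero_ne_one hw

theorem isClosed_positiveParameters_inter_Icc [Nonempty E]
    (hQ : ∀ e, IntegrableOn (Q e) (Icc 0 (T.len e))) (a b : ℝ) :
    IsClosed (T.positiveParameters Q ∩ Icc a b) := by
  have := T.finite_vertices
  have := Fintype.ofFinite V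
  rw [positiveParameters_eq_image hQ, ← image_inter_preimage, inter_assoc,
    inter_comm (Prod.snd ⁻¹' _), ← Set.prod_eq]
  have hcompact : IsCompact (Icc a b ×ˢ Metric.sphere (0 : (V → ℝ) × (E → ℝ)) 1) :=
    isCompact_Icc.prod (isCompact_sphere _ _)
  exact ((hcompact.inter_left (isClosed_rootSupersolutionData hQ)).image continuous_fst).isClosed

/-- The Weyl function of the equation with potential `Q`, where `Φ e` and `Φ' e` are the solution
operators of the edges. -/
noncomputable def potentialWeyl (T : RootedMetricTree V E) (Φ Φ' : E → ℝ → ℝ × ℝ → ℝ → ℝ)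
    (lam : ℝ) : V → ℝ :=
  T.weylFunction fun e r => Φ' e lam (1, r) (T.len e) / Φ e lam (1, r) (T.len e)

theorem potentialWeyl_eq (Φ Φ' : E → ℝ → ℝ × ℝ → ℝ → ℝ) (lam : ℝ) (v : V) :
    T.potentialWeyl Φ Φ' lam v = ∑ e with T.near e = v,
      Φ' e lam (1, T.potentialWeyl Φ Φ' lam (T.far e)) (T.len e) /
        Φ e lam (1, T.potentialWeyl Φ Φ' lam (T.far e)) (T.len e) :=
  T.weylFunction_eq _ v

theorem mem_positiveParameters_of_potentialWeyl
    (hΦ : ∀ e, IsSolutionOperator (T.len e) (Q e) (Φ e) (Φ' e))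
    (hpos : ∀ e, ∀ x ∈ Icc 0 (T.len e), 0 < Φ e lam (1, T.potentialWeyl Φ Φ' lam (T.far e)) x)
    (hroot : 0 ≤ T.potentialWeyl Φ Φ' lam T.root) : lam ∈ T.positiveParameters Q := by
  have hlen (e : E) := hpos e _ (right_mem_Icc.2 (T.len_pos e).le)
  obtain ⟨u, hu₁, hu, h, hflux⟩ := exists_isSolutionOffRoot
    (fun e => (hΦ e).solution lam (1, T.potentialWeyl Φ Φ' lam (T.far e)))
    (fun e => (hΦ e).apply_zero _ _) (fun e => (hΦ e).deriv_zero _ _) (fun e => (hlen e).ne')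
    (potentialWeyl_eq Φ Φ' lam)
  exact ⟨u, _, _, ⟨h, fun e x hx => mul_nonneg (hu hlen _).le (hpos e x hx).le,
    hroot.trans_eq hflux.symm⟩, hu₁ ▸ one_pos⟩

theorem exists_nonpos_mem_positiveParameters (hQ : ∀ e, IntegrableOn (Q e) (Icc 0 (T.len e))) :
    ∃ lam ≤ 0, lam ∈ T.positiveParameters Q := by
  choose Φ Φ' hΦ using fun e => exists_isSolutionOperator (T.len_pos e).le (hQ e)
  obtain ⟨lam, hlam, hlam₀⟩ := ((eventually_all.2 fun e =>
    IsSturmLiouvilleSolution.eventually_atBot_pos (T.len_pos e) (hQ e)).and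
      (eventually_le_atBot 0)).exists
  have hedge (e : E) (r : ℝ) (hr : 0 ≤ r) :=
    hlam e _ _ ((hΦ e).solution lam (1, r)) (by rw [(hΦ e).apply_zero]; exact one_pos)
      (by rwa [(hΦ e).deriv_zero])
  have hweyl := T.weylFunction_mem (AddSubmonoid.nonneg ℝ)
    (G := fun e r => Φ' e lam (1, r) (T.len e) / Φ e lam (1, r) (T.len e)) fun e he =>
      div_nonneg (hedge e _ he).2 ((hedge e _ he).1 _ (right_mem_Icc.2 (T.len_pos e).le)).le
  exact ⟨lam, hlam₀, mem_positiveParameters_of_potentialWeyl hΦ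
    (fun e => (hedge e _ (hweyl _)).1) (hweyl _)⟩

theorem IsSolutionOffRoot.sum_deriv_len_eq_mul_potentialWeyl
    (hQ : ∀ e, IntegrableOn (Q e) (Icc 0 (T.len e)))
    (hΦ : ∀ e, IsSolutionOperator (T.len e) (Q e) (Φ e) (Φ' e))
    (h : T.IsSolutionOffRoot Q lam u y dy) (hu : ∀ e, u (T.near e) ≠ 0) (v : V) :
    ∑ e with T.near e = v, dy e (T.len e) = u v * T.potentialWeyl Φ Φ' lam v := by
  induction v using T.induction_up with
  | h v ih =>
    rw [potentialWeyl_eq, Finset.mul_sum]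
    refine Finset.sum_congr rfl fun e he => ?_
    obtain rfl := (Finset.mem_filter.1 he).2
    have hinit : dy e 0 = y e 0 * T.potentialWeyl Φ Φ' lam (T.far e) := by
      rw [← h.kirchhoff, ih e rfl, h.apply_zero]
    obtain ⟨hy, hdy⟩ := (hΦ e).eq_mul (T.len_pos e).le (hQ e) (h.solution e) hinit _
      (right_mem_Icc.2 (T.len_pos e).le)
    have hne := hu e
    rw [← h.apply_len, hy] at hne
    rw [← h.apply_len, hdy, hy, mul_assoc, mul_div_cancel₀ _ (right_ne_zero_of_mul hne)]

theorem continuousAt_potentialWeyl (hΦ : ∀ e, IsSolutionOperator (T.len e) (Q e) (Φ e) (Φ' e))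
    (hne : ∀ e, Φ e lam (1, T.potentialWeyl Φ Φ' lam (T.far e)) (T.len e) ≠ 0) (v : V) :
    ContinuousAt (fun l => T.potentialWeyl Φ Φ' l v) lam := by
  refine T.continuousAt_weylFunction
    (G := fun l e r => Φ' e l (1, r) (T.len e) / Φ e l (1, r) (T.len e)) (fun e => ?_) v
  have hdata : Continuous fun z : ℝ × ℝ => (z.1, ((1 : ℝ), z.2), T.len e) := by fun_prop
  exact ((hΦ e).continuous_deriv.comp hdata).continuousAt.div
    ((hΦ e).continuous.comp hdata).continuousAt (hne e)

theorem IsRootSupersolution.eventually_mem_positiveParameters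
    (hQ : ∀ e, IntegrableOn (Q e) (Icc 0 (T.len e))) (h : T.IsRootSupersolution Q lam u y dy)
    (hroot : 0 < u T.root) (hflux : 0 < ∑ e with T.near e = T.root, dy e (T.len e)) :
    ∀ᶠ l in 𝓝 lam, l ∈ T.positiveParameters Q := by
  choose Φ Φ' hΦ using fun e => exists_isSolutionOperator (T.len_pos e).le (hQ e)
  have hu (v : V) : u v ≠ 0 := mt (h.apply_eq_zero_iff hQ v).1 hroot.ne'
  have hweyl := h.sum_deriv_len_eq_mul_potentialWeyl hQ hΦ fun e => hu _
  have hpos (e : E) {x : ℝ} (hx : x ∈ Icc 0 (T.len e)) :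
      0 < Φ e lam (1, T.potentialWeyl Φ Φ' lam (T.far e)) x := by
    have hy := ((hΦ e).eq_mul (T.len_pos e).le (hQ e) (h.solution e)
      (by rw [← h.kirchhoff, hweyl, h.apply_zero]) x hx).1
    exact pos_of_mul_pos_right (hy ▸ h.pos hQ hroot.ne' hx)
      (h.nonneg e 0 (left_mem_Icc.2 (T.len_pos e).le))
  have hcont := continuousAt_potentialWeyl hΦ fun e =>
    (hpos e (right_mem_Icc.2 (T.len_pos e).le)).ne'
  have hpos_near : ∀ᶠ l in 𝓝 lam, ∀ e, ∀ x ∈ Icc 0 (T.len e),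
      0 < Φ e l (1, T.potentialWeyl Φ Φ' l (T.far e)) x := by
    refine eventually_all.2 fun e =>
      isCompact_Icc.eventually_forall_of_forall_eventually fun x hx => ?_
    have hdata : ContinuousAt (fun z : ℝ × ℝ =>
        (z.1, ((1 : ℝ), T.potentialWeyl Φ Φ' z.1 (T.far e)), z.2)) (lam, x) :=
      continuousAt_fst.prodMk <| (continuousAt_const.prodMk <|
        (hcont _).comp (x := (lam, x)) continuousAt_fst).prodMk continuousAt_snd
    exact ((hΦ e).continuous.continuousAt.comp hdata).eventually (lt_mem_nhds (hpos e hx))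
  have hroot_weyl : 0 < T.potentialWeyl Φ Φ' lam T.root :=
    pos_of_mul_pos_right (hweyl T.root ▸ hflux) hroot.le
  filter_upwards [hpos_near, (hcont _).eventually (lt_mem_nhds hroot_weyl)] with l hl hl_root
  exact mem_positiveParameters_of_potentialWeyl hΦ hl hl_root.le

theorem IsRootSupersolution.mem_neumannSpectrum [Nonempty E]
    (hQ : ∀ e, IntegrableOn (Q e) (Icc 0 (T.len e))) (h : T.IsRootSupersolution Q lam u y dy)
    (hroot : 0 < u T.root) (hflux : ∑ e with T.near e = T.root, dy e (T.len e) = 0) :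
    lam ∈ T.neumannSpectrum Q :=
  have e := Classical.arbitrary E
  have hzero : 0 ∈ Icc 0 (T.len e) := left_mem_Icc.2 (T.len_pos e).le
  ⟨y, dy, h.isNeumannSolution hflux, e, 0, hzero, (h.pos hQ hroot.ne' hzero).ne'⟩

theorem zero_mem_positiveParameters [Nonempty E]
    (hQ : ∀ e, IntegrableOn (Q e) (Icc 0 (T.len e)))
    (hspec : ∀ lam ∈ T.neumannSpectrum Q, 0 ≤ lam) : 0 ∈ T.positiveParameters Q := by
  obtain ⟨l₁, hl₁, hmem⟩ := exists_nonpos_mem_positiveParameters hQ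
  refine (isClosed_positiveParameters_inter_Icc hQ l₁ 0).mem_of_ge_of_forall_exists_gt hmem hl₁ ?_
  rintro lam ⟨⟨u, y, dy, h, hroot⟩, -, hneg⟩
  have hflux : 0 < ∑ e with T.near e = T.root, dy e (T.len e) :=
    h.flux_nonneg.lt_of_ne fun hflux =>
      hneg.not_ge (hspec lam (h.mem_neumannSpectrum hQ hroot hflux.symm))
  obtain ⟨l, hl, hlt⟩ := ((h.eventually_mem_positiveParameters hQ hroot hflux).filter_mono
    (nhdsWithin_le_nhds (s := Ioi lam)) |>.and (Ioo_mem_nhdsGT hneg)).exists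
  exact ⟨l, hl, hlt.1, hlt.2.le⟩

end GroundState

end RootedMetricTree

theorem theorem1p1_general {V E : Type*} [DecidableEq V] [Fintype E] (T : RootedMetricTree V E)
    (Q : E → ℝ → ℝ) (hQ : ∀ e, IntegrableOn (Q e) (Icc 0 (T.len e)))
    (hsub : T.neumannSpectrum 0 ⊆ T.neumannSpectrum Q)
    (hnonneg : ∀ lam ∈ T.neumannSpectrum Q, 0 ≤ lam) :
    ∀ e, ∀ᵐ x ∂(volume.restrict (Icc 0 (T.len e))), Q e x = 0 := by
  intro e
  have : Nonempty E := ⟨e⟩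
  have hmean : ∑ e, ∫ t in (0)..T.len e, Q e t = 0 :=
    RootedMetricTree.sum_integral_eq_zero_of_neumannSpectrum_zero_subset hQ hsub
  obtain ⟨u, y, dy, hground, hroot⟩ := RootedMetricTree.zero_mem_positiveParameters hQ hnonneg
  exact hground.ae_eq_zero hQ hmean.le hroot e

theorem theorem1p1 {V E : Type*} [Fintype V] [DecidableEq V] [Fintype E]
    (T : RootedMetricTree V E) (Q : E → ℝ → ℝ)
    (hQ : ∀ e, IntegrableOn (Q e) (Icc 0 (T.len e)))
    (hspec : T.neumannSpectrum Q = T.neumannSpectrum 0) :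
    ∀ e, ∀ᵐ x ∂(volume.restrict (Icc 0 (T.len e))), Q e x = 0 :=
  theorem1p1_general T Q hQ hspec.ge fun _ hlam =>
    RootedMetricTree.nonneg_of_mem_neumannSpectrum_zero (hspec ▸ hlam)
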